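/- For $s=(s_1,s_2,s_3)\in\mathbb{C}^3$ consider the triple series $$\zeta_{\mathfrak S}(s_1,s_2,s_3)=\sum_{n_1,n_2,n_3\ge 1}\frac{1}{(n_1+n_2)^{s_1}(n_2+n_3)^{s_2}(n_3+n_1)^{s_3}} .$$ It converges absolutely when $\mathrm{Re}(s_1),\mathrm{Re}(s_2),\mathrm{Re}(s_3)>1$. From this domain it continues analytically to a meromorphic function on all of $\mathbb{C}^3$, whose only singularities are at most simple poles along the hyperplanes $$s_1+s_2=2-k,\qquad s_2+s_3=2-k,\qquad s_3+s_1=2-k,\qquad s_1+s_2+s_3=4-k\qquad(k=1,2,3,\dots).$$ That is, the continuation is holomorphic off the union of these hyperplanes, and near every point $p\in\mathbb{C}^3$ it is the quotient of a function holomorphic near $p$ by a product of pairwise distinct factors, each of the form $s_i+s_j-(2-k)$ with $i\neq j$, $k\geq1$, or $s_1+s_2+s_3-(4-k)$ with $k\ge1$, and each vanishing at $p$. (It is not asserted that each of these hyperplanes is actually a polar hyperplane.) -/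

import Mathlib

open Filter Topology

/-- The general term `(n₁+n₂)^{-s₁} (n₂+n₃)^{-s₂} (n₃+n₁)^{-s₃}` of the symmetric zeta series;
here `s = (s 0, s 1, s 2)`, and `n = (n₁, n₂, n₃)` runs over triples of positive integers. -/
noncomputable def symZetaTerm (s : Fin 3 → ℂ) (n : ℕ+ × ℕ+ × ℕ+) : ℂ :=
  1 / (((n.1 : ℂ) + (n.2.1 : ℂ)) ^ (s 0) *
    ((n.2.1 : ℂ) + (n.2.2 : ℂ)) ^ (s 1) *
    ((n.2.2 : ℂ) + (n.1 : ℂ)) ^ (s 2))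

/-- A function on a complex normed space is meromorphic if near every point it is a quotient
`g / h` of holomorphic functions, with `h` not identically zero near that point. As usual the
values of the function where the denominator vanishes are irrelevant. -/
def IsMeromorphicMV {E : Type*} [NormedAddCommGroup E] [NormedSpace ℂ E] (F : E → ℂ) : Prop :=
  ∀ p : E, ∃ g h : E → ℂ, AnalyticAt ℂ g p ∧ AnalyticAt ℂ h p ∧ ¬ (∀ᶠ s in 𝓝 p, h s = 0) ∧
    ∀ᶠ s in 𝓝 p, h s ≠ 0 → F s = g s / h s

/-- Let `ℓ j` be a family of affine forms with pairwise distinct zero hyperplanes. The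
singularities of `F` are at most simple poles along these hyperplanes: `F` is holomorphic off
their union, and near every point `p` it is the quotient of a holomorphic function by a product,
without repetitions, of forms `ℓ j` whose hyperplanes pass through `p`. -/
def HasOnlySimplePolesAlong {E ι : Type*} [NormedAddCommGroup E] [NormedSpace ℂ E]
    (ℓ : ι → E → ℂ) (F : E → ℂ) : Prop :=
  (∀ p : E, (∀ j, ℓ j p ≠ 0) → AnalyticAt ℂ F p) ∧
  ∀ p : E, ∃ T : Finset ι, (∀ j ∈ T, ℓ j p = 0) ∧
    ∃ g : E → ℂ, AnalyticAt ℂ g p ∧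
      ∀ᶠ s in 𝓝 p, (∀ j, ℓ j s ≠ 0) → F s = g s / ∏ j ∈ T, ℓ j s

/-- The affine forms whose zero sets are the hyperplanes `s₁+s₂ = 2-k`, `s₂+s₃ = 2-k`,
`s₃+s₁ = 2-k` and `s₁+s₂+s₃ = 4-k`, for integers `k ≥ 1`. -/
noncomputable def symZetaForm : Fin 4 × ℕ+ → (Fin 3 → ℂ) → ℂ
  | (0, k), s => s 0 + s 1 - (2 - (k : ℂ))
  | (1, k), s => s 1 + s 2 - (2 - (k : ℂ))
  | (2, k), s => s 2 + s 0 - (2 - (k : ℂ))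
  | (3, k), s => s 0 + s 1 + s 2 - (4 - (k : ℂ))

/-! Multiplying the series by `∏ Γ(sᵢ)` and summing geometric series turns it into the Mellin
transform, over the positive octant, of the symmetric function `∏ 1 / (exp(xᵢ + xⱼ) - 1)`
(`tsum_symZetaTerm_mul_Gamma`). This function is singular at the origin and, to a different order,
along the coordinate axes. So the octant is cut into the six sectors where the coordinates are
ordered, and on `x₀ > x₁ > x₂ > 0` one substitutes `x = (y₀, y₀y₁, y₀y₁y₂)`. All singular behaviour
becomes monomial: the integrand is `y₀^(s₀+s₁+s₂-4) y₁^(s₁+s₂-2) y₂^(s₂-1)` times a function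
holomorphic near the closed box and exponentially decaying in `y₀` (`integrand_blowUp`,
`isSymbol_blowUpSymbol`).

The Mellin transform of such a function is a product of Gamma functions of the three exponents times
an entire function (`IsSymbol.exists_entire`). Integration by parts in each variable gives
contiguity relations, and these continue the normalised transform to the left one unit at a time.

Hence each sector contributes `Γ(s₀+s₁+s₂-3) Γ(sᵢ+sⱼ-1) Γ(sⱼ)` times an entire function, divided by
`Γ(s₀)Γ(s₁)Γ(s₂)`. The factor `Γ(sⱼ)` cancels, so no poles along `sⱼ = -m` survive. The two
remaining Gamma functions have simple poles exactly along hyperplanes of the list, and they belong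
to different families, so no factor is repeated (`exists_local_quotient`). -/

/-! ### Holomorphy of Laplace-type integrals in several variables. -/

open MeasureTheory in
/-- A Laplace-type integral `∫ exp (L x s) φ x dμ` is analytic at every point around which it
converges with room to spare. -/
theorem analyticAt_integral_exp_clm {X E : Type*} [MeasurableSpace X] {μ : Measure X}
    [NormedAddCommGroup E] [NormedSpace ℂ E] {L : X → E →L[ℂ] ℂ} {φ : X → ℂ}
    (hL : AEStronglyMeasurable L μ) (hφ : AEStronglyMeasurable φ μ) {p : E} {r : ℝ} (hr : 0 < r)
    (hint : Integrable (fun x => Real.exp (‖L x‖ * r) * ‖Complex.exp (L x p) * φ x‖) μ) :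
    AnalyticAt ℂ (fun s => ∫ x, Complex.exp (L x s) * φ x ∂μ) p := by
  -- `M k l` is the `k`-linear map `(y₁, …, y_k) ↦ ∏ l yⱼ`. Expanding `exp (L x y)` around `p` and
  -- integrating termwise gives the Taylor coefficients `∫ w x • M k (L x) / k!`.
  set M : (k : ℕ) → (E →L[ℂ] ℂ) → ContinuousMultilinearMap ℂ (fun _ : Fin k => E) ℂ := fun k l =>
    (ContinuousMultilinearMap.mkPiAlgebra ℂ (Fin k) ℂ).compContinuousLinearMap (fun _ => l) with hM
  have hMc : ∀ k, Continuous (M k) := by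
    intro k
    have := (ContinuousMultilinearMap.compContinuousLinearMapContinuousMultilinear ℂ
      (fun _ : Fin k => E) (fun _ : Fin k => ℂ) ℂ).cont
    have h2 := (ContinuousLinearMap.apply ℂ _
      (ContinuousMultilinearMap.mkPiAlgebra ℂ (Fin k) ℂ)).continuous.comp
        (this.comp (continuous_pi (fun _ => continuous_id) :
          Continuous (fun l : E →L[ℂ] ℂ => fun _ : Fin k => l)))
    exact h2
  have hMn : ∀ k l, ‖M k l‖ ≤ ‖l‖ ^ k := by
    intro k l
    refine (ContinuousMultilinearMap.norm_compContinuousLinearMap_le _ _).trans ?_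
    simp [ContinuousMultilinearMap.norm_mkPiAlgebra]
  have hMa : ∀ k l y, M k l (fun _ => y) = l y ^ k := by
    intro k l y
    simp [hM]
  set w : X → ℂ := fun x => Complex.exp (L x p) * φ x with hw
  have hev : ∀ y : E, AEStronglyMeasurable (fun x => L x y) μ := fun y =>
    (ContinuousLinearMap.apply ℂ ℂ y).continuous.comp_aestronglyMeasurable hL
  have hwm : AEStronglyMeasurable w μ :=
    (Complex.continuous_exp.comp_aestronglyMeasurable (hev p)).mul hφ
  set Q : (k : ℕ) → X → ContinuousMultilinearMap ℂ (fun _ : Fin k => E) ℂ := fun k x =>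
    (w x / (k.factorial : ℂ)) • M k (L x) with hQ
  have hQm : ∀ k, AEStronglyMeasurable (Q k) μ := fun k =>
    (by simp only [div_eq_mul_inv]; exact hwm.mul aestronglyMeasurable_const :
      AEStronglyMeasurable (fun x => w x / (k.factorial : ℂ)) μ).smul ((hMc k).comp_aestronglyMeasurable hL)
  have hQn : ∀ k x, ‖Q k x‖ ≤ ‖w x‖ * (‖L x‖ ^ k / k.factorial) := by
    intro k x
    rw [hQ]
    simp only [norm_smul, norm_div, Complex.norm_natCast]
    calc ‖w x‖ / k.factorial * ‖M k (L x)‖ ≤ ‖w x‖ / k.factorial * ‖L x‖ ^ k := by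
          gcongr; exact hMn k _
      _ = _ := by ring
  -- A single term of the exponential series is at most its sum, so `hint` dominates every
  -- coefficient at radius `r`.
  have hQb : ∀ k x, ‖Q k x‖ * r ^ k ≤ Real.exp (‖L x‖ * r) * ‖w x‖ := by
    intro k x
    calc ‖Q k x‖ * r ^ k ≤ ‖w x‖ * (‖L x‖ ^ k / k.factorial) * r ^ k := by
          gcongr; exact hQn k x
      _ = ((‖L x‖ * r) ^ k / k.factorial) * ‖w x‖ := by rw [mul_pow]; ring
      _ ≤ _ := by
          gcongr
          exact Real.pow_div_factorial_le_exp _ (by positivity) k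
  have hQi : ∀ k, Integrable (Q k) μ := by
    intro k
    refine (hint.div_const (r ^ k)).mono' (hQm k) (Eventually.of_forall fun x => ?_)
    rw [le_div_iff₀ (by positivity)]
    exact hQb k x
  let q : FormalMultilinearSeries ℂ E ℂ := fun k => ∫ x, Q k x ∂μ
  lift r to NNReal using hr.le
  have hball : HasFPowerSeriesOnBall (fun s => ∫ x, Complex.exp (L x s) * φ x ∂μ) q p r := by
    refine ⟨?_, by exact_mod_cast hr, ?_⟩
    · refine FormalMultilinearSeries.le_radius_of_bound _
        (∫ x, Real.exp (‖L x‖ * r) * ‖w x‖ ∂μ) fun k => ?_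
      calc ‖q k‖ * (r : ℝ) ^ k ≤ (∫ x, ‖Q k x‖ ∂μ) * (r : ℝ) ^ k := by
            gcongr; exact norm_integral_le_integral_norm _
        _ = ∫ x, ‖Q k x‖ * (r : ℝ) ^ k ∂μ := (integral_mul_const _ _).symm
        _ ≤ _ := integral_mono ((hQi k).norm.mul_const _) hint (hQb k)
    · intro y hy
      have hy' : ‖y‖ < r := by simpa using hy
      have happ : ∀ k, q k (fun _ => y) = ∫ x, w x * ((L x y) ^ k / k.factorial) ∂μ := by
        intro k
        have := (ContinuousMultilinearMap.apply ℂ (fun _ : Fin k => E) ℂ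
          (fun _ => y)).integral_comp_comm (hQi k)
        simp only [ContinuousMultilinearMap.apply_apply] at this
        change (∫ x, Q k x ∂μ) (fun _ => y) = _
        rw [← this]
        refine integral_congr_ae (Eventually.of_forall fun x => ?_)
        simp only [hQ, smul_apply, hMa, smul_eq_mul]
        ring
      simp only [happ]
      have hexp : ∀ x, HasSum (fun k : ℕ => (‖L x‖ * r) ^ k / k.factorial)
          (Real.exp (‖L x‖ * r)) := fun x => by
        rw [Real.exp_eq_exp_ℝ]; exact NormedSpace.expSeries_div_hasSum_exp _
      refine hasSum_integral_of_dominated_convergence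
        (fun k x => ‖w x‖ * ((‖L x‖ * r) ^ k / k.factorial)) ?_ ?_ ?_ ?_ ?_
      · intro k
        simp only [div_eq_mul_inv]
        exact hwm.mul (((hev y).pow k).mul aestronglyMeasurable_const)
      · intro k
        refine Eventually.of_forall fun x => ?_
        simp only [norm_mul, norm_div, norm_pow, Complex.norm_natCast]
        gcongr
        exact (L x).le_opNorm_of_le hy'.le
      · exact Eventually.of_forall fun x => (hexp x).summable.mul_left _
      · refine hint.congr (Eventually.of_forall fun x => ?_)
        change Real.exp (‖L x‖ * ↑r) * ‖w x‖ = ∑' n : ℕ, _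
        rw [tsum_mul_left, (hexp x).tsum_eq, mul_comm]
      · refine Eventually.of_forall fun x => ?_
        have h1 : HasSum (fun k : ℕ => (L x y) ^ k / k.factorial) (Complex.exp (L x y)) := by
          rw [Complex.exp_eq_exp_ℂ]; exact NormedSpace.expSeries_div_hasSum_exp _
        have := h1.mul_left (w x)
        rwa [show w x * Complex.exp (L x y) = Complex.exp (L x (p + y)) * φ x by
          simp only [hw, map_add, Complex.exp_add]; ring] at this
  exact hball.analyticAt

/-! ### Continuation by contiguity relations. -/

/-- Analytic continuation by a contiguity relation: a family of functions, analytic where all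
coordinates have positive real part, each of which is expressed through members of the family
shifted to the right in any one coordinate, consists of restrictions of entire functions. -/
theorem exists_entire_extension_of_shift {X : Type*} (f : X → (Fin 3 → ℂ) → ℂ)
    (D : Fin 3 → X → X) (c : Fin 3 → ℂ → ℂ) (hc : ∀ i, Differentiable ℂ (c i))
    (hf : ∀ x s, (∀ i, 0 < (s i).re) → AnalyticAt ℂ (f x) s)
    (hrec : ∀ i x s, (∀ i, 0 < (s i).re) →
      f x s = c i (s i) * f x (s + Pi.single i 1) - f (D i x) (s + Pi.single i 1)) (x : X) :
    ∃ g : (Fin 3 → ℂ) → ℂ, (∀ s, AnalyticAt ℂ g s) ∧ ∀ s, (∀ i, 0 < (s i).re) → g s = f x s := by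
  -- `T i` is the right-hand side of the recursion. It enlarges the domain of analyticity by one
  -- unit in coordinate `i` and reproduces `f` on the original domain.
  let T : Fin 3 → (X → (Fin 3 → ℂ) → ℂ) → (X → (Fin 3 → ℂ) → ℂ) := fun i h x s =>
    c i (s i) * h x (s + Pi.single i 1) - h (D i x) (s + Pi.single i 1)
  let R : (X → (Fin 3 → ℂ) → ℂ) → (X → (Fin 3 → ℂ) → ℂ) := fun h => T 0 (T 1 (T 2 h))
  let U : (Fin 3 → ℝ) → Set (Fin 3 → ℂ) := fun a => {s | ∀ i, -a i < (s i).re}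
  have hsh : ∀ a i s, s ∈ U (a + Pi.single i 1) → s + Pi.single i 1 ∈ U a := by
    intro a i s hs j
    have := hs j
    by_cases hij : j = i
    · subst hij; simp at this ⊢; linarith
    · simp [hij] at this ⊢; linarith
  have hTan : ∀ i a h, (∀ x, ∀ s ∈ U a, AnalyticAt ℂ (h x) s) →
      ∀ x, ∀ s ∈ U (a + Pi.single i 1), AnalyticAt ℂ (T i h x) s := by
    intro i a h hh x s hs
    have h1 : AnalyticAt ℂ (fun s : Fin 3 → ℂ => s + Pi.single i 1) s :=
      analyticAt_id.add analyticAt_const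
    have h2 : AnalyticAt ℂ (fun s : Fin 3 → ℂ => c i (s i)) s :=
      AnalyticAt.comp ((hc i).analyticAt _)
        ((ContinuousLinearMap.proj (R := ℂ) (φ := fun _ : Fin 3 => ℂ) i).analyticAt s)
    exact (h2.mul (AnalyticAt.comp (hh x _ (hsh a i s hs)) h1)).sub
      (AnalyticAt.comp (hh (D i x) _ (hsh a i s hs)) h1)
  have hTeq : ∀ i a h h', (∀ x, ∀ s ∈ U a, h x s = h' x s) →
      ∀ x, ∀ s ∈ U (a + Pi.single i 1), T i h x s = T i h' x s := by
    intro i a h h' hh x s hs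
    simp only [T]
    rw [hh x _ (hsh a i s hs), hh _ _ (hsh a i s hs)]
  let V : ℕ → Set (Fin 3 → ℂ) := fun n => U (fun _ => n)
  have hVU : ∀ n : ℕ, V (n + 1) =
      U ((((fun _ => (n : ℝ)) + Pi.single 2 1) + Pi.single 1 1) + Pi.single 0 1) := by
    intro n
    change U _ = U _
    refine congrArg U ?_
    funext i
    fin_cases i <;> simp
  have hmono : ∀ m n : ℕ, m ≤ n → V m ⊆ V n := by
    intro m n hmn s hs i
    have := hs i
    have h2 : (m : ℝ) ≤ n := by exact_mod_cast hmn
    linarith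
  have hRan : ∀ n h, (∀ x, ∀ s ∈ V n, AnalyticAt ℂ (h x) s) →
      ∀ x, ∀ s ∈ V (n + 1), AnalyticAt ℂ (R h x) s := by
    intro n h hh x s hs
    rw [hVU] at hs
    exact hTan 0 _ _ (hTan 1 _ _ (hTan 2 _ _ hh)) x s hs
  have hReq : ∀ n h h', (∀ x, ∀ s ∈ V n, h x s = h' x s) →
      ∀ x, ∀ s ∈ V (n + 1), R h x s = R h' x s := by
    intro n h h' hh x s hs
    rw [hVU] at hs
    exact hTeq 0 _ _ _ (hTeq 1 _ _ _ (hTeq 2 _ _ _ hh)) x s hs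
  have hV0 : ∀ s, s ∈ V 0 ↔ ∀ i, 0 < (s i).re := by
    intro s; simp [V, U]
  have hTf : ∀ i h, (∀ x, ∀ s ∈ V 0, h x s = f x s) → ∀ x, ∀ s ∈ V 0, T i h x s = f x s := by
    intro i h hh x s hs
    rw [hrec i x s ((hV0 s).1 hs)]
    have : s + Pi.single i 1 ∈ V 0 := by
      rw [hV0] at hs ⊢
      intro j
      have := hs j
      by_cases hij : j = i
      · subst hij; simp; linarith
      · simpa [hij] using this
    simp only [T]
    rw [hh x _ this, hh _ _ this]
  have hRf : ∀ x, ∀ s ∈ V 0, R f x s = f x s :=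
    hTf 0 _ (hTf 1 _ (hTf 2 _ (fun _ _ _ => rfl)))
  let g : ℕ → X → (Fin 3 → ℂ) → ℂ := fun n => R^[n] f
  have hg1 : ∀ n, g (n + 1) = R (g n) := fun n => Function.iterate_succ_apply' R n f
  have hgan : ∀ n x, ∀ s ∈ V n, AnalyticAt ℂ (g n x) s := by
    intro n
    induction n with
    | zero => intro x s hs; exact hf x s ((hV0 s).1 hs)
    | succ n ih => intro x s hs; rw [hg1]; exact hRan n _ ih x s hs
  -- Consecutive iterates agree because `R` is applied to the identity `R f = f` on `V 0`; no
  -- identity theorem enters.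
  have hgs : ∀ n x, ∀ s ∈ V n, g (n + 1) x s = g n x s := by
    intro n
    induction n with
    | zero => exact hRf
    | succ n ih => intro x s hs; rw [hg1 (n + 1)]; nth_rw 2 [hg1 n]; exact hReq n _ _ ih x s hs
  have hgm : ∀ m n, m ≤ n → ∀ x, ∀ s ∈ V m, g n x s = g m x s := by
    intro m n hmn x s hs
    induction n, hmn using Nat.le_induction with
    | base => rfl
    | succ n hmn ih => rw [hgs n x s (hmono m n hmn hs), ih]
  have hex : ∀ s, ∃ n, s ∈ V n := by
    intro s
    obtain ⟨n, hn⟩ := exists_nat_gt (∑ i, |(s i).re|)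
    refine ⟨n, fun i => ?_⟩
    have h1 := Finset.single_le_sum (f := fun i => |(s i).re|) (fun i _ => abs_nonneg _)
      (Finset.mem_univ i)
    have h2 := neg_abs_le (s i).re
    linarith
  choose N hN using hex
  have hG : ∀ n, ∀ s ∈ V n, g (N s) x s = g n x s := by
    intro n s hs
    rcases le_total n (N s) with h | h
    · exact hgm _ _ h x s hs
    · exact (hgm _ _ h x s (hN s)).symm
  have hopen : ∀ n, IsOpen (V n) := by
    intro n
    have : V n = ⋂ i : Fin 3, {s | -(n : ℝ) < (s i).re} := by
      ext s; simp [V, U]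
    rw [this]
    exact isOpen_iInter_of_finite fun i => isOpen_lt continuous_const
      (Complex.continuous_re.comp (continuous_apply i))
  refine ⟨fun s => g (N s) x s, fun s => ?_, fun s hs => ?_⟩
  · refine (hgan (N s) x s (hN s)).congr ?_
    filter_upwards [(hopen (N s)).mem_nhds (hN s)] with t ht
    exact (hG _ t ht).symm
  · exact hG 0 s ((hV0 s).2 hs)

/-! ### Symbols on the blow-up box. -/

namespace SymZeta

open MeasureTheory Set

/-- The sides `(0, ∞) × (0, 1) × (0, 1)` of the box of blow-up coordinates. -/
def side (i : Fin 3) : Set ℝ := if i = 0 then Ioi 0 else Ioo 0 1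

/-- The closures of the sides of the box. -/
def closedSide (i : Fin 3) : Set ℝ := if i = 0 then Ici 0 else Icc 0 1

/-- Lebesgue measure on the box. -/
noncomputable def boxMeasure : Measure (Fin 3 → ℝ) := Measure.pi fun i => volume.restrict (side i)

/-- A real point, seen as a complex point. -/
noncomputable def toC (x : Fin 3 → ℝ) : Fin 3 → ℂ := fun i => (x i : ℂ)

/-- A factor that vanishes at the right end of the bounded sides. -/
noncomputable def cut (i : Fin 3) (z : ℂ) : ℂ := if i = 0 then 1 else 1 - z

/-- Functions holomorphic near the closed box, all of whose derivatives decay exponentially in the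
unbounded direction. -/
def IsSymbol (Ψ : (Fin 3 → ℂ) → ℂ) : Prop :=
  ∃ r > 0, ∃ C : ℝ, ∃ m : ℕ, ∀ x : Fin 3 → ℝ, (∀ i, x i ∈ closedSide i) →
    ∀ z, ‖z - toC x‖ < r / (1 + x 0) →
      AnalyticAt ℂ Ψ z ∧ ‖Ψ z‖ ≤ C * (1 + x 0) ^ m * Real.exp (-x 0)

/-- The derivative in direction `i`, damped at the right end of the bounded sides. -/
noncomputable def dampedDeriv (i : Fin 3) (Ψ : (Fin 3 → ℂ) → ℂ) : (Fin 3 → ℂ) → ℂ :=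
  fun z => cut i (z i) * fderiv ℂ Ψ z (Pi.single i 1)

theorem side_subset_closedSide (i : Fin 3) : side i ⊆ closedSide i := by
  unfold side closedSide
  split_ifs
  · exact Ioi_subset_Ici_self
  · exact Ioo_subset_Icc_self

theorem pos_of_mem_side {i : Fin 3} {t : ℝ} (h : t ∈ side i) : 0 < t := by
  unfold side at h
  split_ifs at h
  · exact h
  · exact h.1

theorem nonneg_of_mem_closedSide {i : Fin 3} {t : ℝ} (h : t ∈ closedSide i) : 0 ≤ t := by
  unfold closedSide at h
  split_ifs at h
  · exact h
  · exact h.1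

theorem measurableSet_side (i : Fin 3) : MeasurableSet (side i) := by
  unfold side
  split_ifs
  · exact measurableSet_Ioi
  · exact measurableSet_Ioo

theorem boxMeasure_eq : boxMeasure = volume.restrict (univ.pi side) := by
  rw [boxMeasure, volume_pi, Measure.restrict_pi_pi]

theorem measurableSet_box : MeasurableSet (univ.pi side) :=
  MeasurableSet.univ_pi measurableSet_side

theorem ae_boxMeasure : ∀ᵐ x ∂boxMeasure, ∀ i, x i ∈ side i := by
  rw [boxMeasure_eq]
  filter_upwards [ae_restrict_mem measurableSet_box] with x hx i
  exact hx i (mem_univ i)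

theorem analyticAt_coord (i : Fin 3) (z : Fin 3 → ℂ) :
    AnalyticAt ℂ (fun z : Fin 3 → ℂ => z i) z :=
  (ContinuousLinearMap.proj (R := ℂ) (φ := fun _ : Fin 3 => ℂ) i).analyticAt z

theorem analyticAt_cut (i : Fin 3) (z : Fin 3 → ℂ) :
    AnalyticAt ℂ (fun z : Fin 3 → ℂ => cut i (z i)) z := by
  unfold cut
  split_ifs
  · exact analyticAt_const
  · exact analyticAt_const.sub (analyticAt_coord i z)

/-- Cauchy's estimate on a disc of radius comparable to `1 / (1 + x 0)` costs one factor `1 + x 0`.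
The arbitrary power `m` in `IsSymbol` absorbs it, so the class is stable under iteration. -/
theorem IsSymbol.dampedDeriv {Ψ : (Fin 3 → ℂ) → ℂ} (h : IsSymbol Ψ) (i : Fin 3) :
    IsSymbol (dampedDeriv i Ψ) := by
  obtain ⟨r, hr, C, m, H⟩ := h
  -- A radius at most `r / 2` leaves room for a Cauchy disc of radius `ρ = r / 2 / (1 + x 0)`, the
  -- source of `2 / r`; a radius at most `1 / 2` bounds the damping factor by `3`.
  refine ⟨min r 1 / 2, by positivity, 3 * C * (2 / r), m + 1, fun x hx z hz => ?_⟩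
  have hx0 : 0 ≤ x 0 := nonneg_of_mem_closedSide (hx 0)
  have h1 : 0 < 1 + x 0 := by linarith
  have hz1 : ‖z - toC x‖ < r / 2 / (1 + x 0) := by
    refine hz.trans_le ?_
    gcongr
    exact min_le_left _ _
  have hz2 : ‖z - toC x‖ < 1 := by
    refine hz.trans_le ?_
    rw [div_le_one h1]
    have := min_le_right r 1
    linarith
  have hz3 : r / 2 / (1 + x 0) < r / (1 + x 0) := by gcongr; linarith
  have hA := (H x hx z (hz1.trans hz3)).1
  refine ⟨(analyticAt_cut i z).mul ?_, ?_⟩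
  · exact (ContinuousLinearMap.apply ℂ ℂ (Pi.single i 1 : Fin 3 → ℂ)).analyticAt _ |>.comp hA.fderiv
  have hcut : ‖cut i (z i)‖ ≤ 3 := by
    unfold cut
    split_ifs with hi
    · simp
    · have hxi := hx i
      simp only [closedSide, if_neg hi, mem_Icc] at hxi
      have h3 : ‖z i - x i‖ ≤ 1 := (norm_le_pi_norm (z - toC x) i).trans hz2.le
      calc ‖1 - z i‖ = ‖((1 - x i : ℝ) : ℂ) - (z i - x i)‖ := by push_cast; ring_nf
        _ ≤ ‖((1 - x i : ℝ) : ℂ)‖ + ‖z i - x i‖ := norm_sub_le _ _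
        _ ≤ 1 + 1 := by
          gcongr
          rw [Complex.norm_real, Real.norm_eq_abs, abs_le]
          constructor <;> linarith
        _ ≤ 3 := by norm_num
  set ρ := r / 2 / (1 + x 0) with hρ
  have hρ0 : 0 < ρ := by positivity
  have hline : ∀ w : ℂ, ‖w‖ ≤ ρ → ‖z + w • (Pi.single i 1 : Fin 3 → ℂ) - toC x‖ < r / (1 + x 0) := by
    intro w hw
    have hn : ‖(Pi.single i 1 : Fin 3 → ℂ)‖ = 1 := by simp [Pi.norm_single]
    calc ‖z + w • (Pi.single i 1 : Fin 3 → ℂ) - toC x‖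
        = ‖(z - toC x) + w • (Pi.single i 1 : Fin 3 → ℂ)‖ := by congr 1; abel
      _ ≤ ‖z - toC x‖ + ‖w • (Pi.single i 1 : Fin 3 → ℂ)‖ := norm_add_le _ _
      _ = ‖z - toC x‖ + ‖w‖ := by rw [norm_smul, hn, mul_one]
      _ < ρ + ρ := by linarith
      _ = r / (1 + x 0) := by rw [hρ]; ring
  have hd : ∀ w : ℂ, ‖w‖ ≤ ρ → HasDerivAt (fun w : ℂ => Ψ (z + w • (Pi.single i 1 : Fin 3 → ℂ)))
      (fderiv ℂ Ψ (z + w • (Pi.single i 1 : Fin 3 → ℂ)) (Pi.single i 1)) w := by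
    intro w hw
    have h4 := (H x hx _ (hline w hw)).1.differentiableAt.hasFDerivAt
    have h5 : HasDerivAt (fun w : ℂ => z + w • (Pi.single i 1 : Fin 3 → ℂ)) (Pi.single i 1) w := by
      simpa using ((hasDerivAt_id w).smul_const (Pi.single i 1 : Fin 3 → ℂ)).const_add z
    exact h4.comp_hasDerivAt w h5
  have hb : ‖fderiv ℂ Ψ z (Pi.single i 1)‖ ≤ C * (1 + x 0) ^ m * Real.exp (-x 0) / ρ := by
    have h6 := (hd 0 (by simpa using hρ0.le)).deriv
    rw [zero_smul, add_zero] at h6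
    rw [← h6]
    refine Complex.norm_deriv_le_of_forall_mem_sphere_norm_le hρ0 ?_ ?_
    · refine DifferentiableOn.diffContOnCl fun w hw => ?_
      have : ‖w‖ ≤ ρ := by
        simpa using Metric.closure_ball_subset_closedBall hw
      exact (hd w this).differentiableAt.differentiableWithinAt
    · intro w hw
      exact (H x hx _ (hline w (by simpa using (mem_sphere_zero_iff_norm.1 hw).le))).2
  have hC : 0 ≤ C * (1 + x 0) ^ m * Real.exp (-x 0) := (norm_nonneg _).trans (H x hx z (hz1.trans hz3)).2
  calc ‖SymZeta.dampedDeriv i Ψ z‖ = ‖cut i (z i)‖ * ‖fderiv ℂ Ψ z (Pi.single i 1)‖ := norm_mul _ _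
    _ ≤ 3 * (C * (1 + x 0) ^ m * Real.exp (-x 0) / ρ) := by gcongr
    _ = _ := by rw [hρ, pow_succ]; field_simp

theorem IsSymbol.analyticAt {Ψ : (Fin 3 → ℂ) → ℂ} (h : IsSymbol Ψ) {x : Fin 3 → ℝ}
    (hx : ∀ i, x i ∈ closedSide i) : AnalyticAt ℂ Ψ (toC x) := by
  obtain ⟨r, hr, C, m, H⟩ := h
  have hx0 : 0 ≤ x 0 := nonneg_of_mem_closedSide (hx 0)
  exact (H x hx (toC x) (by simp; positivity)).1

theorem IsSymbol.exists_bound {Ψ : (Fin 3 → ℂ) → ℂ} (h : IsSymbol Ψ) :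
    ∃ C, 0 ≤ C ∧ ∀ x : Fin 3 → ℝ, (∀ i, x i ∈ closedSide i) →
      ‖Ψ (toC x)‖ ≤ C * Real.exp (-(1 / 2) * x 0) := by
  obtain ⟨r, hr, C, m, H⟩ := h
  refine ⟨|C| * (2 ^ m * m.factorial * Real.exp (1 / 2)), by positivity, fun x hx => ?_⟩
  have hx0 : 0 ≤ x 0 := nonneg_of_mem_closedSide (hx 0)
  have h1 := (H x hx (toC x) (by simp; positivity)).2
  have h2 := Real.pow_div_factorial_le_exp ((1 + x 0) / 2) (by positivity) m
  rw [div_pow, div_div, div_le_iff₀ (by positivity)] at h2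
  calc ‖Ψ (toC x)‖ ≤ C * (1 + x 0) ^ m * Real.exp (-x 0) := h1
    _ ≤ |C| * (Real.exp ((1 + x 0) / 2) * (2 ^ m * m.factorial)) * Real.exp (-x 0) := by
        gcongr
        exact le_abs_self C
    _ = |C| * (2 ^ m * m.factorial) * (Real.exp ((1 + x 0) / 2) * Real.exp (-x 0)) := by ring
    _ = |C| * (2 ^ m * m.factorial) * (Real.exp (1 / 2) * Real.exp (-(1 / 2) * x 0)) := by
        rw [← Real.exp_add, ← Real.exp_add]; ring_nf
    _ = _ := by ring

theorem continuous_toC : Continuous toC :=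
  continuous_pi fun i => Complex.continuous_ofReal.comp (continuous_apply i)

theorem IsSymbol.aestronglyMeasurable {Ψ : (Fin 3 → ℂ) → ℂ} (h : IsSymbol Ψ) :
    AEStronglyMeasurable (fun x => Ψ (toC x)) boxMeasure := by
  rw [boxMeasure_eq]
  refine ContinuousOn.aestronglyMeasurable (fun x hx => ?_) measurableSet_box
  have h1 := h.analyticAt (x := x) fun i => side_subset_closedSide i (hx i (mem_univ i))
  exact (h1.continuousAt.comp (f := toC) continuous_toC.continuousAt).continuousWithinAt

/-! ### Mellin transforms over the box: convergence and holomorphy. -/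

/-- The monomial `∏ xᵢ ^ (sᵢ - 1)`. -/
noncomputable def monom (s : Fin 3 → ℂ) (x : Fin 3 → ℝ) : ℂ := ∏ i, (x i : ℂ) ^ (s i - 1)

/-- The Mellin transform over the box. -/
noncomputable def boxMellin (Ψ : (Fin 3 → ℂ) → ℂ) (s : Fin 3 → ℂ) : ℂ :=
  ∫ x, monom s x * Ψ (toC x) ∂boxMeasure

/-- The linear form `s ↦ ∑ sᵢ log xᵢ`. -/
noncomputable def logForm (x : Fin 3 → ℝ) : (Fin 3 → ℂ) →L[ℂ] ℂ :=
  ∑ i, (Real.log (x i) : ℂ) • ContinuousLinearMap.proj (R := ℂ) (φ := fun _ : Fin 3 => ℂ) i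

theorem logForm_apply (x : Fin 3 → ℝ) (s : Fin 3 → ℂ) :
    logForm x s = ∑ i, (Real.log (x i) : ℂ) * s i := by
  simp [logForm]

theorem norm_logForm_le (x : Fin 3 → ℝ) : ‖logForm x‖ ≤ ∑ i, |Real.log (x i)| := by
  refine ContinuousLinearMap.opNorm_le_bound _ (Finset.sum_nonneg fun _ _ => abs_nonneg _)
    fun s => ?_
  rw [logForm_apply, Finset.sum_mul]
  refine (norm_sum_le _ _).trans (Finset.sum_le_sum fun i _ => ?_)
  rw [norm_mul, Complex.norm_real, Real.norm_eq_abs]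
  gcongr
  exact norm_le_pi_norm s i

theorem measurable_logForm : Measurable logForm := by
  unfold logForm
  refine Finset.measurable_fun_sum _ fun i _ => ?_
  exact ((Complex.measurable_ofReal.comp (Real.measurable_log.comp (measurable_pi_apply i)))).smul_const _

theorem measurable_exp_logForm (s : Fin 3 → ℂ) : Measurable fun x => Complex.exp (logForm x s) :=
  Complex.measurable_exp.comp
    ((ContinuousLinearMap.apply ℂ ℂ s).continuous.measurable.comp measurable_logForm)

/-- Separates the exponential of a form linear in `s` from the fixed factor `∏ xᵢ⁻¹`, the shape
required by `analyticAt_integral_exp_clm`. -/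
theorem monom_eq_exp {x : Fin 3 → ℝ} (hx : ∀ i, 0 < x i) (s : Fin 3 → ℂ) :
    monom s x = Complex.exp (logForm x s) * Complex.exp (logForm x (-1)) := by
  rw [← Complex.exp_add, ← map_add, logForm_apply, Complex.exp_sum, monom]
  refine Finset.prod_congr rfl fun i _ => ?_
  rw [Complex.cpow_def_of_ne_zero (by exact_mod_cast (hx i).ne'), Complex.ofReal_log (hx i).le]
  simp [sub_eq_add_neg]

theorem exp_mul_abs_log_le {t r : ℝ} (ht : 0 < t) : Real.exp (|Real.log t| * r) ≤ t ^ r + t ^ (-r) := by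
  rw [Real.rpow_def_of_pos ht, Real.rpow_def_of_pos ht]
  rcases abs_cases (Real.log t) with h | h
  · rw [h.1]; linarith [Real.exp_pos (Real.log t * -r)]
  · rw [h.1, show -Real.log t * r = Real.log t * -r by ring]; linarith [Real.exp_pos (Real.log t * r)]

theorem integrableOn_side {i : Fin 3} {a : ℝ} (ha : 0 < a) :
    IntegrableOn (fun t : ℝ => t ^ (a - 1) * (if i = 0 then Real.exp (-(1 / 2) * t) else 1)) (side i) := by
  unfold side
  split_ifs with h
  · have := integrableOn_rpow_mul_exp_neg_mul_rpow (p := 1) (s := a - 1) (b := 1 / 2)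
      (by linarith) one_pos (by norm_num)
    simpa using this
  · have := (intervalIntegral.integrableOn_Ioo_rpow_iff (s := a - 1) one_pos).2 (by linarith)
    simpa using this

/-- The factor `exp (‖logForm x‖ * r)` costs at most `∏ (xᵢ^r + xᵢ^(-r))`. The integrand is
therefore dominated by a product of one-variable integrands with exponents `Re pᵢ ± r - 1 > -1`. -/
theorem IsSymbol.integrable_exp {Ψ : (Fin 3 → ℂ) → ℂ} (h : IsSymbol Ψ) {p : Fin 3 → ℂ}
    {r : ℝ} (hr : 0 ≤ r) (hp : ∀ i, r < (p i).re) :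
    Integrable (fun x => Real.exp (‖logForm x‖ * r) *
      ‖Complex.exp (logForm x p) * (Complex.exp (logForm x (-1)) * Ψ (toC x))‖) boxMeasure := by
  obtain ⟨C, hC, hb⟩ := h.exists_bound
  have hdom : Integrable (fun x : Fin 3 → ℝ => C * ∏ i,
      ((x i ^ ((p i).re + r - 1) * (if i = 0 then Real.exp (-(1 / 2) * x i) else 1)) +
      (x i ^ ((p i).re - r - 1) * (if i = 0 then Real.exp (-(1 / 2) * x i) else 1)))) boxMeasure := by
    refine Integrable.const_mul ?_ C
    refine Integrable.fintype_prod (μ := fun i => volume.restrict (side i))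
      (f := fun (i : Fin 3) (t : ℝ) =>
      (t ^ ((p i).re + r - 1) * (if i = 0 then Real.exp (-(1 / 2) * t) else 1)) +
      (t ^ ((p i).re - r - 1) * (if i = 0 then Real.exp (-(1 / 2) * t) else 1))) fun i => ?_
    exact (integrableOn_side (by linarith [hp i])).add (integrableOn_side (by linarith [hp i]))
  refine hdom.mono' ?_ ?_
  · refine AEStronglyMeasurable.mul ?_ ?_
    · exact (Real.measurable_exp.comp (measurable_logForm.norm.mul_const r)).aestronglyMeasurable
    · exact ((measurable_exp_logForm p).aestronglyMeasurable.mul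
        ((measurable_exp_logForm _).aestronglyMeasurable.mul h.aestronglyMeasurable)).norm
  · filter_upwards [ae_boxMeasure] with x hx
    have hx' : ∀ i, 0 < x i := fun i => pos_of_mem_side (hx i)
    rw [← mul_assoc, ← monom_eq_exp hx', Real.norm_of_nonneg (by positivity), norm_mul]
    have h1 : ‖monom p x‖ = ∏ i, x i ^ ((p i).re - 1) := by
      rw [monom, norm_prod]
      refine Finset.prod_congr rfl fun i _ => ?_
      rw [Complex.norm_cpow_eq_rpow_re_of_pos (hx' i)]; simp
    have h2 : Real.exp (‖logForm x‖ * r) ≤ ∏ i, (x i ^ r + x i ^ (-r)) := by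
      calc Real.exp (‖logForm x‖ * r) ≤ Real.exp ((∑ i, |Real.log (x i)|) * r) := by
            gcongr; exact norm_logForm_le x
        _ = ∏ i, Real.exp (|Real.log (x i)| * r) := by rw [Finset.sum_mul, Real.exp_sum]
        _ ≤ _ := Finset.prod_le_prod (fun _ _ => (Real.exp_pos _).le)
            fun i _ => exp_mul_abs_log_le (hx' i)
    have h3 : Real.exp (-(1 / 2) * x 0) = ∏ i, (if i = 0 then Real.exp (-(1 / 2) * x i) else 1) := by
      simp
    calc Real.exp (‖logForm x‖ * r) * (‖monom p x‖ * ‖Ψ (toC x)‖)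
        ≤ (∏ i, (x i ^ r + x i ^ (-r))) * ((∏ i, x i ^ ((p i).re - 1)) *
          (C * ∏ i, (if i = 0 then Real.exp (-(1 / 2) * x i) else 1))) := by
          rw [h1, ← h3]
          have h4 : 0 ≤ ∏ i, x i ^ ((p i).re - 1) :=
            Finset.prod_nonneg fun i _ => Real.rpow_nonneg (hx' i).le _
          have h5 : 0 ≤ ∏ i, (x i ^ r + x i ^ (-r)) := (Real.exp_pos _).le.trans h2
          gcongr
          exact hb x fun i => side_subset_closedSide i (hx i)
      _ = C * ((∏ i, (x i ^ r + x i ^ (-r))) * (∏ i, x i ^ ((p i).re - 1)) *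
          ∏ i, (if i = 0 then Real.exp (-(1 / 2) * x i) else 1)) := by ring
      _ = _ := by
          rw [← Finset.prod_mul_distrib, ← Finset.prod_mul_distrib]
          congr 1
          refine Finset.prod_congr rfl fun i _ => ?_
          rw [← add_mul, add_mul, ← Real.rpow_add (hx' i), ← Real.rpow_add (hx' i)]
          ring_nf

theorem IsSymbol.integrable_monom_mul {Ψ : (Fin 3 → ℂ) → ℂ} (h : IsSymbol Ψ) {s : Fin 3 → ℂ}
    (hs : ∀ i, 0 < (s i).re) : Integrable (fun x => monom s x * Ψ (toC x)) boxMeasure := by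
  have h1 := h.integrable_exp le_rfl hs
  simp only [mul_zero, Real.exp_zero, one_mul] at h1
  have h2 : AEStronglyMeasurable (fun x => Complex.exp (logForm x s) *
      (Complex.exp (logForm x (-1)) * Ψ (toC x))) boxMeasure :=
    (measurable_exp_logForm s).aestronglyMeasurable.mul
      ((measurable_exp_logForm _).aestronglyMeasurable.mul h.aestronglyMeasurable)
  refine ((integrable_norm_iff h2).1 h1).congr ?_
  filter_upwards [ae_boxMeasure] with x hx
  rw [monom_eq_exp fun i => pos_of_mem_side (hx i), mul_assoc]

theorem IsSymbol.analyticAt_boxMellin {Ψ : (Fin 3 → ℂ) → ℂ} (h : IsSymbol Ψ) {s : Fin 3 → ℂ}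
    (hs : ∀ i, 0 < (s i).re) : AnalyticAt ℂ (boxMellin Ψ) s := by
  have hr : ∃ r > 0, ∀ i, r < (s i).re := by
    have h0 := hs 0; have h1 := hs 1; have h2 := hs 2
    refine ⟨min (s 0).re (min (s 1).re (s 2).re) / 2, by positivity, fun i => ?_⟩
    have a0 := min_le_left (s 0).re (min (s 1).re (s 2).re)
    have a1 := min_le_right (s 0).re (min (s 1).re (s 2).re)
    have a2 := min_le_left (s 1).re (s 2).re
    have a3 := min_le_right (s 1).re (s 2).re
    have a4 : 0 < min (s 0).re (min (s 1).re (s 2).re) := by positivity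
    fin_cases i <;> simp <;> linarith
  obtain ⟨r, hr0, hr⟩ := hr
  have key := analyticAt_integral_exp_clm measurable_logForm.aestronglyMeasurable
    ((measurable_exp_logForm (-1)).aestronglyMeasurable.mul h.aestronglyMeasurable) hr0
    (h.integrable_exp hr0.le hr)
  refine key.congr (Eventually.of_forall fun t => ?_)
  refine integral_congr_ae ?_
  filter_upwards [ae_boxMeasure] with x hx
  rw [monom_eq_exp fun i => pos_of_mem_side (hx i), mul_assoc]
  rfl

/-! ### Integration by parts and the contiguity relation. -/

theorem integral_side_deriv_eq_zero {i : Fin 3} {h h' : ℝ → ℂ}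
    (hd : ∀ t ∈ side i, HasDerivAt h (h' t) t) (h0 : h 0 = 0)
    (hzero : Tendsto h (𝓝[>] 0) (𝓝 0)) (htop : i = 0 → Tendsto h atTop (𝓝 0))
    (hone : i ≠ 0 → Tendsto h (𝓝[<] 1) (𝓝 0)) : ∫ t in side i, h' t = 0 := by
  -- A non-integrable function has integral `0` by convention, so integrability need not be assumed.
  by_cases hint : IntegrableOn h' (side i)
  swap
  · exact integral_undef hint
  unfold side at hd hint ⊢
  split_ifs at hd hint ⊢ with hi
  · rw [integral_Ioi_of_hasDerivAt_of_tendsto ?_ hd hint (htop hi), h0, sub_zero]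
    rw [← continuousWithinAt_Ioi_iff_Ici]
    simpa [ContinuousWithinAt, h0] using hzero
  · rw [← integral_Ioc_eq_integral_Ioo, ← intervalIntegral.integral_of_le zero_le_one,
      intervalIntegral.integral_eq_sub_of_hasDerivAt_of_tendsto one_pos hd ?_ hzero (hone hi),
      sub_zero]
    rw [intervalIntegrable_iff_integrableOn_Ioc_of_le zero_le_one]
    exact (integrableOn_Ioc_iff_integrableOn_Ioo).2 hint

/-- Fubini with the `i`-th variable innermost; the non-integrable case again holds by convention. -/
theorem integral_boxMeasure_eq_zero (i : Fin 3) {G : (Fin 3 → ℝ) → ℂ}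
    (hG : ∀ y : Fin 2 → ℝ, (∀ j, y j ∈ side (i.succAbove j)) →
      ∫ t in side i, G (i.insertNth t y) = 0) :
    ∫ x, G x ∂boxMeasure = 0 := by
  by_cases hint : Integrable G boxMeasure
  swap
  · exact integral_undef hint
  have mp := measurePreserving_piFinSuccAbove
    (fun i : Fin 3 => (volume.restrict (side i) : Measure ℝ)) i
  have mp' := mp.symm
  have e1 := mp'.integral_comp' G
  have hi2 : Integrable (G ∘ (MeasurableEquiv.piFinSuccAbove (fun _ => ℝ) i).symm)
      ((volume.restrict (side i)).prod
        (Measure.pi fun j => volume.restrict (side (i.succAbove j)))) :=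
    (mp'.integrable_comp_emb (MeasurableEquiv.measurableEmbedding _)).2 hint
  rw [boxMeasure, ← e1]
  have e2 := integral_prod_symm _ hi2
  refine e2.trans ?_
  rw [← integral_zero (Fin 2 → ℝ) ℂ]
  refine integral_congr_ae ?_
  have hae : ∀ᵐ y ∂(Measure.pi fun j : Fin 2 => (volume.restrict (side (i.succAbove j)) : Measure ℝ)),
      ∀ j, y j ∈ side (i.succAbove j) := by
    rw [← Measure.restrict_pi_pi]
    filter_upwards [ae_restrict_mem (MeasurableSet.univ_pi fun j => measurableSet_side _)] with y hy j
    exact hy j (mem_univ j)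
  filter_upwards [hae] with y hy
  exact hG y hy

/-- The coefficient in the contiguity relation. -/
noncomputable def shiftCoeff (i : Fin 3) (z : ℂ) : ℂ := if i = 0 then 0 else z + 1

theorem monom_insertNth (i : Fin 3) (s : Fin 3 → ℂ) (t : ℝ) (y : Fin 2 → ℝ) :
    monom s (i.insertNth t y) =
      (t : ℂ) ^ (s i - 1) * ∏ j, (y j : ℂ) ^ (s (i.succAbove j) - 1) := by
  rw [monom, Fin.prod_univ_succAbove _ i]
  simp

theorem hasDerivAt_symbol_insertNth {Ψ : (Fin 3 → ℂ) → ℂ} (i : Fin 3) (t : ℝ)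
    (y : Fin 2 → ℝ) (h : AnalyticAt ℂ Ψ (toC (i.insertNth t y))) :
    HasDerivAt (fun t : ℝ => Ψ (toC (i.insertNth t y)))
      (fderiv ℂ Ψ (toC (i.insertNth t y)) (Pi.single i 1)) t := by
  refine (h.differentiableAt.hasFDerivAt.restrictScalars ℝ).comp_hasDerivAt t
    (f := fun t : ℝ => toC (i.insertNth t y)) ?_
  rw [hasDerivAt_pi]
  rw [Fin.forall_iff_succAbove i]
  constructor
  · have : HasDerivAt (fun t : ℝ => (t : ℂ)) 1 t := Complex.ofRealCLM.hasDerivAt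
    simpa [toC] using this
  · intro j
    simpa [toC, Pi.single_eq_of_ne (Fin.succAbove_ne i j)] using hasDerivAt_const t ((y j : ℂ))

theorem insertNth_mem_side {i : Fin 3} {t : ℝ} {y : Fin 2 → ℝ} (ht : t ∈ side i)
    (hy : ∀ j, y j ∈ side (i.succAbove j)) (k : Fin 3) :
    (i.insertNth t y : Fin 3 → ℝ) k ∈ side k := by
  revert k
  rw [Fin.forall_iff_succAbove i]
  exact ⟨by simpa using ht, fun j => by simpa using hy j⟩

/-- Integrate the `i`-th partial derivative of `t^(sᵢ) * cut i t * Ψ`. The factor `cut`, equal to `1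
- t` on a bounded side, kills the boundary term at `t = 1`, which would otherwise be a transform in
fewer variables. Its own derivative produces `shiftCoeff`. -/
theorem IsSymbol.mul_boxMellin {Ψ : (Fin 3 → ℂ) → ℂ} (h : IsSymbol Ψ) (i : Fin 3) {s : Fin 3 → ℂ}
    (hs : ∀ i, 0 < (s i).re) :
    s i * boxMellin Ψ s = shiftCoeff i (s i) * boxMellin Ψ (s + Pi.single i 1)
      - boxMellin (SymZeta.dampedDeriv i Ψ) (s + Pi.single i 1) := by
  have hs' : ∀ j, 0 < ((s + Pi.single i 1 : Fin 3 → ℂ) j).re := by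
    intro j
    have := hs j
    by_cases hij : j = i
    · subst hij; simp; linarith
    · simpa [hij] using this
  have hI1 := (h.integrable_monom_mul hs).const_mul (s i)
  have hI2 := (h.integrable_monom_mul hs').const_mul (shiftCoeff i (s i))
  have hI3 := (h.dampedDeriv i).integrable_monom_mul hs'
  suffices ∫ x, (s i * (monom s x * Ψ (toC x))
      - shiftCoeff i (s i) * (monom (s + Pi.single i 1) x * Ψ (toC x))
      + monom (s + Pi.single i 1) x * SymZeta.dampedDeriv i Ψ (toC x)) ∂boxMeasure = 0 by
    have e1 := integral_add (hI1.sub hI2) hI3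
    have e2 := integral_sub hI1 hI2
    rw [integral_const_mul, integral_const_mul] at e2
    simp only [Pi.sub_apply] at e1
    rw [this, e2] at e1
    unfold boxMellin
    linear_combination -e1
  refine integral_boxMeasure_eq_zero i fun y hy => ?_
  obtain ⟨C, hC, hb⟩ := h.exists_bound
  set A : ℂ := ∏ j, (y j : ℂ) ^ (s (i.succAbove j) - 1) with hA
  have hm : ∀ t : ℝ, monom s (i.insertNth t y) = (t : ℂ) ^ (s i - 1) * A := fun t =>
    monom_insertNth i s t y
  have hm' : ∀ t : ℝ, monom (s + Pi.single i 1) (i.insertNth t y) = (t : ℂ) ^ (s i) * A := by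
    intro t
    rw [monom_insertNth, hA]
    simp
  set σ := (s i).re with hσ
  have hσ0 : 0 < σ := hs i
  have hsi : s i ≠ 0 := by
    intro h0; rw [hσ, h0] at hσ0; simp at hσ0
  have hbound : ∀ t ∈ side i, ‖(t : ℂ) ^ (s i) * A * cut i t * Ψ (toC (i.insertNth t y))‖ ≤
      t ^ σ * ‖A‖ * ‖cut i t‖ * (C * if i = 0 then Real.exp (-(1 / 2) * t) else 1) := by
    intro t ht
    have ht0 := pos_of_mem_side ht
    rw [norm_mul, norm_mul, norm_mul, Complex.norm_cpow_eq_rpow_re_of_pos ht0]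
    have hmem := insertNth_mem_side ht hy
    gcongr
    refine (hb _ fun k => side_subset_closedSide k (hmem k)).trans ?_
    gcongr
    split_ifs with hi
    · subst hi; simp
    · rw [Real.exp_le_one_iff]
      have := pos_of_mem_side (hmem 0)
      linarith
  have hside0 : side i ∈ 𝓝[>] (0 : ℝ) := by
    unfold side
    split_ifs
    · exact self_mem_nhdsWithin
    · exact Ioo_mem_nhdsGT one_pos
  refine integral_side_deriv_eq_zero (i := i)
    (h := fun t => (t : ℂ) ^ (s i) * A * cut i t * Ψ (toC (i.insertNth t y))) ?_ ?_ ?_ ?_ ?_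
  · intro t ht
    have ht0 := pos_of_mem_side ht
    have hmem := insertNth_mem_side ht hy
    have d1 : HasDerivAt (fun t : ℝ => (t : ℂ) ^ (s i)) (s i * (t : ℂ) ^ (s i - 1)) t := by
      have := (hasDerivAt_id (t : ℂ)).cpow_const (c := s i) (Or.inl (by simpa using ht0))
      simpa using this.comp_ofReal
    have d2 : HasDerivAt (fun t : ℝ => cut i t) (if i = 0 then 0 else -1) t := by
      unfold cut
      split_ifs
      · exact hasDerivAt_const _ _
      · have : HasDerivAt (fun t : ℝ => (t : ℂ)) 1 t := Complex.ofRealCLM.hasDerivAt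
        exact this.const_sub 1
    have d3 := hasDerivAt_symbol_insertNth i t y
      (h.analyticAt fun k => side_subset_closedSide k (hmem k))
    refine (((d1.mul_const A).mul d2).mul d3).congr_deriv ?_
    symm
    rw [hm, hm', SymZeta.dampedDeriv]
    have htc : toC (i.insertNth t y) i = t := by simp [toC]
    rw [htc]
    have hpow : (t : ℂ) ^ (s i) = t * (t : ℂ) ^ (s i - 1) := by
      rw [Complex.cpow_sub _ _ (by exact_mod_cast ht0.ne'), Complex.cpow_one]
      field_simp [show (t : ℂ) ≠ 0 by exact_mod_cast ht0.ne']
    unfold shiftCoeff cut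
    simp only [Pi.mul_apply]
    split_ifs
    · ring
    · rw [hpow]; ring
  · simp [Complex.zero_cpow hsi]
  · have hlim : Tendsto (fun t : ℝ => t ^ σ * (‖A‖ * 1 * C)) (𝓝[>] 0) (𝓝 0) := by
      have : ContinuousAt (fun t : ℝ => t ^ σ * (‖A‖ * 1 * C)) 0 :=
        (Real.continuousAt_rpow_const _ _ (Or.inr hσ0.le)).mul continuousAt_const
      have h2 := this.tendsto.mono_left (nhdsWithin_le_nhds (s := Ioi 0))
      simpa [Real.zero_rpow hσ0.ne'] using h2
    refine squeeze_zero_norm' ?_ hlim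
    filter_upwards [hside0] with t ht
    refine (hbound t ht).trans ?_
    have ht0 := pos_of_mem_side ht
    have hcut : ‖cut i t‖ ≤ 1 := by
      unfold cut
      unfold side at ht
      split_ifs at ht ⊢ with hi
      · simp
      · rw [show (1 : ℂ) - t = ((1 - t : ℝ) : ℂ) by push_cast; ring, Complex.norm_real,
          Real.norm_eq_abs, abs_le]
        constructor <;> linarith [ht.1, ht.2]
    have he : (C * if i = 0 then Real.exp (-(1 / 2) * t) else 1) ≤ C := by
      refine mul_le_of_le_one_right hC ?_
      split_ifs
      · rw [Real.exp_le_one_iff]; linarith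
      · exact le_rfl
    calc t ^ σ * ‖A‖ * ‖cut i t‖ * (C * if i = 0 then Real.exp (-(1 / 2) * t) else 1)
        ≤ t ^ σ * ‖A‖ * 1 * C := by gcongr
      _ = _ := by ring
  · intro hi
    have hlim := (tendsto_rpow_mul_exp_neg_mul_atTop_nhds_zero σ (1 / 2) (by norm_num)).const_mul
      (‖A‖ * C)
    rw [mul_zero] at hlim
    refine squeeze_zero_norm' ?_ hlim
    filter_upwards [Ioi_mem_atTop 0] with t ht
    refine (hbound t (by simpa [side, hi] using ht)).trans (le_of_eq ?_)
    simp [cut, hi]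
    ring
  · intro hi
    have hlim : Tendsto (fun t : ℝ => t ^ σ * ‖A‖ * ‖cut i t‖ * (C * 1)) (𝓝[<] 1) (𝓝 0) := by
      have : ContinuousAt (fun t : ℝ => t ^ σ * ‖A‖ * ‖cut i t‖ * (C * 1)) 1 := by
        refine ContinuousAt.mul (ContinuousAt.mul (ContinuousAt.mul
          (Real.continuousAt_rpow_const _ _ (Or.inr hσ0.le)) continuousAt_const) ?_)
          continuousAt_const
        simp only [cut, if_neg hi]
        fun_prop
      have h2 := this.tendsto.mono_left (nhdsWithin_le_nhds (s := Iio 1))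
      simpa [cut, hi] using h2
    refine squeeze_zero_norm' ?_ hlim
    filter_upwards [Ioo_mem_nhdsLT one_pos] with t ht
    have := hbound t (by simpa [side, hi] using ht)
    simpa only [if_neg hi] using this

/-- The Mellin transform of a symbol over the box, divided by the product of the Gamma functions of
its variables, is the restriction of an entire function. -/
theorem IsSymbol.exists_entire {Ψ : (Fin 3 → ℂ) → ℂ} (h : IsSymbol Ψ) :
    ∃ g : (Fin 3 → ℂ) → ℂ, (∀ s, AnalyticAt ℂ g s) ∧ ∀ s, (∀ i, 0 < (s i).re) →
      boxMellin Ψ s = g s * ∏ i, Complex.Gamma (s i) := by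
  let f : {Ψ // IsSymbol Ψ} → (Fin 3 → ℂ) → ℂ := fun Ψ s =>
    boxMellin Ψ.1 s * ∏ i, (Complex.Gamma (s i))⁻¹
  have hΓ : ∀ s : ℂ, 0 < s.re → Complex.Gamma s ≠ 0 := fun s hs => Complex.Gamma_ne_zero_of_re_pos hs
  have hc : ∀ i, Differentiable ℂ (shiftCoeff i) := by
    intro i
    unfold shiftCoeff
    split_ifs <;> fun_prop
  have hf : ∀ (Ψ : {Ψ // IsSymbol Ψ}) (s : Fin 3 → ℂ), (∀ i, 0 < (s i).re) →
      AnalyticAt ℂ (f Ψ) s := by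
    intro Ψ s hs
    refine (Ψ.2.analyticAt_boxMellin hs).mul ?_
    refine Finset.analyticAt_fun_prod _ fun i _ => ?_
    exact AnalyticAt.comp (g := fun z => (Complex.Gamma z)⁻¹)
      (Complex.differentiable_one_div_Gamma.analyticAt _) (analyticAt_coord i s)
  obtain ⟨g, hg, hgf⟩ := exists_entire_extension_of_shift f
    (fun i Ψ => ⟨SymZeta.dampedDeriv i Ψ.1, Ψ.2.dampedDeriv i⟩) shiftCoeff hc hf
    (fun i Ψ s hs => by
      -- Since `1 / Γ(s) = s / Γ(s + 1)`, the normalisation absorbs the factor `s i` on the left of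
      -- the contiguity relation, so nothing has to be divided by `s i`.
      have hprod : ∏ j, (Complex.Gamma (s j))⁻¹ =
          s i * ∏ j, (Complex.Gamma ((s + Pi.single i 1 : Fin 3 → ℂ) j))⁻¹ := by
        have hsi : s i ≠ 0 := by
          intro h0; have := hs i; rw [h0] at this; simp at this
        rw [Fin.prod_univ_succAbove _ i, Fin.prod_univ_succAbove _ i]
        simp only [Pi.add_apply, Pi.single_eq_same, Complex.Gamma_add_one _ hsi, mul_inv,
          Pi.single_eq_of_ne (Fin.succAbove_ne i _), add_zero]
        field_simp
      simp only [f]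
      rw [hprod]
      linear_combination (∏ j, (Complex.Gamma ((s + Pi.single i 1 : Fin 3 → ℂ) j))⁻¹) *
        Ψ.2.mul_boxMellin i hs) ⟨Ψ, h⟩
  refine ⟨g, hg, fun s hs => ?_⟩
  rw [hgf s hs]
  simp only [f]
  rw [Finset.prod_inv_distrib, mul_assoc, inv_mul_cancel₀, mul_one]
  exact Finset.prod_ne_zero_iff.2 fun i _ => hΓ _ (hs i)

/-! ### The Bernoulli generating function and the integrand on the box. -/

/-- The generating function `z / (exp z - 1)` of the Bernoulli numbers. -/
noncomputable def bern (z : ℂ) : ℂ := (dslope Complex.exp 0 z)⁻¹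

/-- The zeros of `(exp z - 1) / z` are the nonzero multiples of `2πi`, and `3 < 2π`. -/
theorem dslope_exp_ne_zero {z : ℂ} (hz : |z.im| ≤ 3) : dslope Complex.exp 0 z ≠ 0 := by
  by_cases h0 : z = 0
  · subst h0; simp
  · rw [dslope_of_ne _ h0, slope_def_field, sub_zero, Complex.exp_zero]
    refine div_ne_zero ?_ h0
    intro h
    obtain ⟨n, hn⟩ := Complex.exp_eq_one_iff.1 (sub_eq_zero.1 h)
    have him : z.im = n * (2 * Real.pi) := by rw [hn]; simp
    have hn0 : n = 0 := by
      by_contra hne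
      have h1 : (1 : ℝ) ≤ |(n : ℝ)| := by exact_mod_cast Int.one_le_abs hne
      rw [him, abs_mul, abs_of_pos Real.two_pi_pos] at hz
      nlinarith [Real.pi_gt_three]
    rw [hn0] at hn
    exact h0 (by simpa using hn)

theorem analyticAt_bern {z : ℂ} (hz : |z.im| ≤ 3) : AnalyticAt ℂ bern z := by
  refine AnalyticAt.inv ?_ (dslope_exp_ne_zero hz)
  have : Differentiable ℂ (dslope Complex.exp 0) := by
    rw [← differentiableOn_univ, Complex.differentiableOn_dslope univ_mem]
    exact Complex.differentiable_exp.differentiableOn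
  exact this.analyticAt z

theorem bern_ofReal {x : ℝ} (hx : 0 < x) : bern (x : ℂ) = x / (Real.exp x - 1 : ℝ) := by
  have h : (x : ℂ) ≠ 0 := by exact_mod_cast hx.ne'
  rw [bern, dslope_of_ne _ h, slope_def_field, sub_zero, Complex.exp_zero, inv_div]
  push_cast
  rfl

/-- For `x ≤ 2` the point `z` stays in a compact disc where `bern` is continuous. For `x ≥ 2`, `exp
(x - 1) ≥ 2`, so subtracting `1` from `exp z` at most halves the lower bound `exp (x - 1)` for its
modulus. -/
theorem exists_bern_bound : ∃ C : ℝ, 0 ≤ C ∧ ∀ x : ℝ, 0 ≤ x → ∀ z : ℂ, ‖z - x‖ ≤ 1 →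
    ‖bern z‖ ≤ C * ((1 + x) * Real.exp (-x)) := by
  obtain ⟨M, hM⟩ := (isCompact_closedBall (0 : ℂ) 3).exists_bound_of_continuousOn (f := bern)
    fun z hz => by
      refine (analyticAt_bern ?_).continuousAt.continuousWithinAt
      exact (Complex.abs_im_le_norm z).trans (by simpa using hz)
  have hM0 : 0 ≤ M := (norm_nonneg _).trans (hM 0 (by simp))
  refine ⟨M * Real.exp 2 + 2 * Real.exp 1, by positivity, fun x hx z hz => ?_⟩
  have hzn : ‖z‖ ≤ 1 + x := by
    calc ‖z‖ = ‖(z - x) + x‖ := by ring_nf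
      _ ≤ ‖z - x‖ + ‖(x : ℂ)‖ := norm_add_le _ _
      _ ≤ 1 + x := by rw [Complex.norm_real, Real.norm_of_nonneg hx]; linarith
  have hE : 0 ≤ (1 + x) * Real.exp (-x) := by positivity
  rcases le_total x 2 with h2 | h2
  · calc ‖bern z‖ ≤ M * 1 := by
          rw [mul_one]; exact hM z (by simp; linarith)
      _ ≤ M * (Real.exp 2 * ((1 + x) * Real.exp (-x))) := by
          gcongr
          have h3 : 1 ≤ Real.exp 2 * Real.exp (-x) := by
            rw [← Real.exp_add]; exact Real.one_le_exp (by linarith)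
          nlinarith
      _ ≤ _ := by
          rw [← mul_assoc]
          gcongr
          linarith [Real.exp_pos 1]
  · have hre : x - 1 ≤ z.re := by
      have := (Complex.abs_re_le_norm (z - x)).trans hz
      rw [Complex.sub_re, Complex.ofReal_re] at this
      linarith [(abs_le.1 this).1]
    have hz0 : z ≠ 0 := by
      rintro rfl; simp at hre; linarith
    have hexp : Real.exp (x - 1) / 2 ≤ ‖Complex.exp z - 1‖ := by
      have h3 := norm_sub_norm_le (Complex.exp z) 1
      rw [Complex.norm_exp, norm_one] at h3
      have h4 : Real.exp (x - 1) ≤ Real.exp z.re := Real.exp_le_exp.2 hre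
      have h5 := Real.add_one_le_exp (x - 1)
      linarith
    rw [bern, dslope_of_ne _ hz0, slope_def_field, sub_zero, Complex.exp_zero, inv_div, norm_div]
    calc ‖z‖ / ‖Complex.exp z - 1‖ ≤ (1 + x) / (Real.exp (x - 1) / 2) := by gcongr
      _ = 2 * Real.exp 1 * ((1 + x) * Real.exp (-x)) := by
          rw [show Real.exp (x - 1) = Real.exp x / Real.exp 1 from Real.exp_sub _ _, Real.exp_neg]
          field_simp
      _ ≤ _ := by
          gcongr
          have : 0 ≤ M * Real.exp 2 := by positivity
          linarith

/-- The integrand of the symmetric zeta series in blow-up coordinates. -/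
noncomputable def blowUpSymbol (z : Fin 3 → ℂ) : ℂ :=
  bern (z 0 * (1 + z 1)) * bern (z 0 * z 1 * (1 + z 2)) * bern (z 0 * (1 + z 1 * z 2)) *
    ((1 + z 1)⁻¹ * (1 + z 2)⁻¹ * (1 + z 1 * z 2)⁻¹)

theorem norm_inv_one_add_le {w : ℂ} {x : ℝ} (hx : 0 ≤ x) (h : ‖w - x‖ ≤ 1 / 2) :
    1 + w ≠ 0 ∧ ‖(1 + w)⁻¹‖ ≤ 2 := by
  have h1 : 1 / 2 ≤ ‖1 + w‖ := by
    have h2 := norm_sub_norm_le ((1 + x : ℝ) : ℂ) ((x : ℂ) - w)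
    rw [Complex.norm_real, Real.norm_of_nonneg (by linarith), norm_sub_rev] at h2
    have h3 : ((1 + x : ℝ) : ℂ) - (x - w) = 1 + w := by push_cast; ring
    rw [h3] at h2
    linarith
  refine ⟨fun h0 => ?_, ?_⟩
  · rw [h0, norm_zero] at h1; linarith
  · rw [norm_inv]
    exact inv_le_of_inv_le₀ (by norm_num) (by linarith)

/-- The arguments of `bern` are products containing `z 0`, so a perturbation of `z 1` or `z 2` is
amplified by `x 0`; hence the width `1 / (1 + x 0)` in `IsSymbol`. The first argument is at least `x
0` at real points and supplies the decay; the other two factors are merely bounded. -/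
theorem isSymbol_blowUpSymbol : IsSymbol blowUpSymbol := by
  obtain ⟨C, hC, hb⟩ := exists_bern_bound
  -- The radius keeps each argument of `bern` within `1` of its real value. In `16`, a factor `2`
  -- comes from `1 + X1 ≤ 2 * (1 + x 0)` and `8` from the three inverses.
  refine ⟨1 / 10, by norm_num, 16 * C ^ 3, 1, fun x hx z hz => ?_⟩
  have hx0 : 0 ≤ x 0 := nonneg_of_mem_closedSide (hx 0)
  have hx1 : x 1 ∈ Icc (0 : ℝ) 1 := by simpa [closedSide] using hx 1
  have hx2 : x 2 ∈ Icc (0 : ℝ) 1 := by simpa [closedSide] using hx 2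
  set ε : ℝ := 1 / 10 / (1 + x 0) with hε
  have hε1 : ε ≤ 1 / 10 := div_le_self (by norm_num) (by linarith)
  have hε2 : x 0 * ε ≤ 1 / 10 := by
    rw [hε, mul_div_assoc', div_le_iff₀ (by linarith)]; linarith
  have hε0 : 0 < ε := by positivity
  have hd : ∀ i, ‖z i - x i‖ ≤ ε := fun i => (norm_le_pi_norm (z - toC x) i).trans hz.le
  have hn1 : ‖z 1‖ ≤ 11 / 10 := by
    calc ‖z 1‖ = ‖(z 1 - x 1) + x 1‖ := by ring_nf
      _ ≤ ‖z 1 - x 1‖ + ‖(x 1 : ℂ)‖ := norm_add_le _ _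
      _ ≤ _ := by rw [Complex.norm_real, Real.norm_of_nonneg hx1.1]; linarith [hd 1, hx1.2]
  have hn2 : ‖z 2‖ ≤ 11 / 10 := by
    calc ‖z 2‖ = ‖(z 2 - x 2) + x 2‖ := by ring_nf
      _ ≤ ‖z 2 - x 2‖ + ‖(x 2 : ℂ)‖ := norm_add_le _ _
      _ ≤ _ := by rw [Complex.norm_real, Real.norm_of_nonneg hx2.1]; linarith [hd 2, hx2.2]
  have hx0n : ‖(x 0 : ℂ)‖ = x 0 := by rw [Complex.norm_real, Real.norm_of_nonneg hx0]
  have hx1n : ‖(x 1 : ℂ)‖ ≤ 1 := by rw [Complex.norm_real, Real.norm_of_nonneg hx1.1]; exact hx1.2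
  have h1z1 : ‖1 + z 1‖ ≤ 21 / 10 := (norm_add_le _ _).trans (by rw [norm_one]; linarith)
  have h1z2 : ‖1 + z 2‖ ≤ 21 / 10 := (norm_add_le _ _).trans (by rw [norm_one]; linarith)
  have h12 : ‖z 1 * z 2‖ ≤ 121 / 100 := by
    rw [norm_mul]; nlinarith [norm_nonneg (z 1), norm_nonneg (z 2)]
  have h1z12 : ‖1 + z 1 * z 2‖ ≤ 221 / 100 :=
    (norm_add_le _ _).trans (by rw [norm_one]; linarith)
  set X1 : ℝ := x 0 * (1 + x 1)
  set X2 : ℝ := x 0 * x 1 * (1 + x 2)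
  set X3 : ℝ := x 0 * (1 + x 1 * x 2)
  have hX1 : 0 ≤ X1 := mul_nonneg hx0 (by linarith [hx1.1])
  have hX2 : 0 ≤ X2 := mul_nonneg (mul_nonneg hx0 hx1.1) (by linarith [hx2.1])
  have hX3 : 0 ≤ X3 := mul_nonneg hx0 (by nlinarith [hx1.1, hx2.1])
  have a1 : ‖z 0 * (1 + z 1) - X1‖ ≤ 1 := by
    calc ‖z 0 * (1 + z 1) - X1‖ = ‖(z 0 - x 0) * (1 + z 1) + x 0 * (z 1 - x 1)‖ := by
          congr 1; simp only [X1]; push_cast; ring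
      _ ≤ ‖z 0 - x 0‖ * ‖1 + z 1‖ + x 0 * ‖z 1 - x 1‖ := by
          refine (norm_add_le _ _).trans ?_
          rw [norm_mul, norm_mul, hx0n]
      _ ≤ ε * (21 / 10) + x 0 * ε := by
          gcongr
          exacts [hd 0, hd 1]
      _ ≤ 1 := by linarith
  have a2 : ‖z 0 * z 1 * (1 + z 2) - X2‖ ≤ 1 := by
    calc ‖z 0 * z 1 * (1 + z 2) - X2‖ = ‖(z 0 - x 0) * (z 1 * (1 + z 2)) +
            x 0 * (z 1 - x 1) * (1 + z 2) + x 0 * (z 2 - x 2) * x 1‖ := by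
          congr 1; simp only [X2]; push_cast; ring
      _ ≤ ‖z 0 - x 0‖ * (‖z 1‖ * ‖1 + z 2‖) + x 0 * ‖z 1 - x 1‖ * ‖1 + z 2‖ +
            x 0 * ‖z 2 - x 2‖ * ‖(x 1 : ℂ)‖ := by
          refine (norm_add₃_le).trans ?_
          simp only [norm_mul, hx0n]
          exact le_rfl
      _ ≤ ε * (11 / 10 * (21 / 10)) + x 0 * ε * (21 / 10) + x 0 * ε * 1 := by
          gcongr
          exacts [hd 0, hd 1, hd 2]
      _ ≤ 1 := by linarith
  have a3 : ‖z 0 * (1 + z 1 * z 2) - X3‖ ≤ 1 := by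
    calc ‖z 0 * (1 + z 1 * z 2) - X3‖ = ‖(z 0 - x 0) * (1 + z 1 * z 2) +
            x 0 * (z 1 - x 1) * z 2 + x 0 * (z 2 - x 2) * x 1‖ := by
          congr 1; simp only [X3]; push_cast; ring
      _ ≤ ‖z 0 - x 0‖ * ‖1 + z 1 * z 2‖ + x 0 * ‖z 1 - x 1‖ * ‖z 2‖ +
            x 0 * ‖z 2 - x 2‖ * ‖(x 1 : ℂ)‖ := by
          refine (norm_add₃_le).trans ?_
          simp only [norm_mul, hx0n]
          exact le_rfl
      _ ≤ ε * (221 / 100) + x 0 * ε * (11 / 10) + x 0 * ε * 1 := by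
          gcongr
          exacts [hd 0, hd 1, hd 2]
      _ ≤ 1 := by linarith
  have a4 : ‖z 1 * z 2 - (x 1 * x 2 : ℝ)‖ ≤ 1 / 2 := by
    calc ‖z 1 * z 2 - (x 1 * x 2 : ℝ)‖ = ‖(z 1 - x 1) * z 2 + (z 2 - x 2) * x 1‖ := by
          congr 1; push_cast; ring
      _ ≤ ‖z 1 - x 1‖ * ‖z 2‖ + ‖z 2 - x 2‖ * ‖(x 1 : ℂ)‖ := by
          refine (norm_add_le _ _).trans ?_
          rw [norm_mul, norm_mul]
      _ ≤ ε * (11 / 10) + ε * 1 := by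
          gcongr
          exacts [hd 1, hd 2]
      _ ≤ 1 / 2 := by linarith
  have him : ∀ (w : ℂ) (X : ℝ), ‖w - X‖ ≤ 1 → |w.im| ≤ 3 := by
    intro w X h
    have := (Complex.abs_im_le_norm (w - X)).trans h
    rw [Complex.sub_im, Complex.ofReal_im, sub_zero] at this
    linarith
  obtain ⟨n1, i1⟩ := norm_inv_one_add_le hx1.1 ((hd 1).trans (by linarith))
  obtain ⟨n2, i2⟩ := norm_inv_one_add_le hx2.1 ((hd 2).trans (by linarith))
  obtain ⟨n3, i3⟩ := norm_inv_one_add_le (mul_nonneg hx1.1 hx2.1) a4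
  have c0 := analyticAt_coord 0 z
  have c1 := analyticAt_coord 1 z
  have c2 := analyticAt_coord 2 z
  have one : AnalyticAt ℂ (fun _ : Fin 3 → ℂ => (1 : ℂ)) z := analyticAt_const
  constructor
  · refine AnalyticAt.mul (AnalyticAt.mul (AnalyticAt.mul ?_ ?_) ?_) ?_
    · exact AnalyticAt.comp (g := bern) (analyticAt_bern (him _ _ a1)) (c0.mul (one.add c1))
    · exact AnalyticAt.comp (g := bern) (analyticAt_bern (him _ _ a2))
        ((c0.mul c1).mul (one.add c2))
    · exact AnalyticAt.comp (g := bern) (analyticAt_bern (him _ _ a3))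
        (c0.mul (one.add (c1.mul c2)))
    · exact (((one.add c1).inv n1).mul ((one.add c2).inv n2)).mul ((one.add (c1.mul c2)).inv n3)
  have hle : ∀ X : ℝ, (1 + X) * Real.exp (-X) ≤ 1 := by
    intro X
    rw [Real.exp_neg, mul_inv_le_iff₀ (Real.exp_pos _)]
    linarith [Real.add_one_le_exp X]
  have b1 : ‖bern (z 0 * (1 + z 1))‖ ≤ C * ((2 * (1 + x 0)) * Real.exp (-x 0)) := by
    refine (hb _ hX1 _ a1).trans ?_
    have h1 : x 0 ≤ X1 := by simp only [X1]; nlinarith [hx1.1]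
    have h2 : X1 ≤ 2 * x 0 := by simp only [X1]; nlinarith [hx1.2]
    gcongr
    linarith
  have b2 : ‖bern (z 0 * z 1 * (1 + z 2))‖ ≤ C :=
    (hb _ hX2 _ a2).trans (mul_le_of_le_one_right hC (hle _))
  have b3 : ‖bern (z 0 * (1 + z 1 * z 2))‖ ≤ C :=
    (hb _ hX3 _ a3).trans (mul_le_of_le_one_right hC (hle _))
  unfold blowUpSymbol
  simp only [norm_mul]
  calc _ ≤ C * ((2 * (1 + x 0)) * Real.exp (-x 0)) * C * C * (2 * 2 * 2) := by gcongr
    _ = _ := by ring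

/-! ### The weight, the blow-up of a sector and the decomposition of the octant. -/

/-- The function `1 / (exp t - 1)`. -/
noncomputable def planck (t : ℝ) : ℂ := 1 / ((Real.exp t - 1 : ℝ) : ℂ)

/-- The weight whose Mellin transform is the symmetric zeta series. -/
noncomputable def weight (x : Fin 3 → ℝ) : ℂ := ∏ i, planck ((∑ j, x j) - x i)

theorem weight_comp_perm (x : Fin 3 → ℝ) (σ : Equiv.Perm (Fin 3)) : weight (x ∘ σ) = weight x := by
  unfold weight
  simp only [Function.comp_apply, Equiv.sum_comp σ x]
  exact Equiv.prod_comp σ fun i => planck ((∑ j, x j) - x i)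

theorem monom_comp_perm (s : Fin 3 → ℂ) (x : Fin 3 → ℝ) (σ : Equiv.Perm (Fin 3)) :
    monom (s ∘ σ) (x ∘ σ) = monom s x :=
  Equiv.prod_comp σ fun i => (x i : ℂ) ^ (s i - 1)

theorem planck_eq_bern {t : ℝ} (ht : 0 < t) : planck t = bern t / t := by
  have : (t : ℂ) ≠ 0 := by exact_mod_cast ht.ne'
  rw [planck, bern_ofReal ht]
  field_simp

/-- The sector of decreasing triples of positive numbers. -/
def sector : Set (Fin 3 → ℝ) := {x | x 1 < x 0 ∧ x 2 < x 1 ∧ 0 < x 2}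

/-- The parametrization of the sector by the box. -/
def blowUp (y : Fin 3 → ℝ) : Fin 3 → ℝ := ![y 0, y 0 * y 1, y 0 * y 1 * y 2]

/-- The exponents in blow-up coordinates. -/
def blowUpExponent (s : Fin 3 → ℂ) : Fin 3 → ℂ := ![s 0 + s 1 + s 2 - 3, s 1 + s 2 - 1, s 2]

/-- The Jacobian matrix of the parametrization. -/
def blowUpJacobian (y : Fin 3 → ℝ) : Matrix (Fin 3) (Fin 3) ℝ :=
  !![1, 0, 0; y 1, y 0, 0; y 1 * y 2, y 0 * y 2, y 0 * y 1]

theorem hasFDerivAt_blowUp (y : Fin 3 → ℝ) :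
    HasFDerivAt blowUp (LinearMap.toContinuousLinearMap (Matrix.toLin' (blowUpJacobian y))) y := by
  rw [hasFDerivAt_pi']
  have h0 := hasFDerivAt_apply (𝕜 := ℝ) (F' := fun _ : Fin 3 => ℝ) (0 : Fin 3) y
  have h1 := hasFDerivAt_apply (𝕜 := ℝ) (F' := fun _ : Fin 3 => ℝ) (1 : Fin 3) y
  have h2 := hasFDerivAt_apply (𝕜 := ℝ) (F' := fun _ : Fin 3 => ℝ) (2 : Fin 3) y
  intro i
  fin_cases i
  · refine h0.congr_fderiv ?_
    ext v
    simp [blowUpJacobian, Matrix.toLin'_apply, dotProduct, Fin.sum_univ_three]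
  · refine (h0.mul h1).congr_fderiv ?_
    ext v
    simp [blowUpJacobian, Matrix.toLin'_apply, dotProduct, Fin.sum_univ_three]
    ring
  · refine ((h0.mul h1).mul h2).congr_fderiv ?_
    ext v
    simp [blowUpJacobian, Matrix.toLin'_apply, dotProduct, Fin.sum_univ_three]
    ring

theorem det_blowUp (y : Fin 3 → ℝ) :
    (LinearMap.toContinuousLinearMap (Matrix.toLin' (blowUpJacobian y))).det = y 0 ^ 2 * y 1 := by
  rw [ContinuousLinearMap.det, LinearMap.coe_toContinuousLinearMap, LinearMap.det_toLin',
    Matrix.det_fin_three]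
  simp [blowUpJacobian]
  ring

theorem mem_box_iff {y : Fin 3 → ℝ} :
    y ∈ univ.pi side ↔ 0 < y 0 ∧ (0 < y 1 ∧ y 1 < 1) ∧ (0 < y 2 ∧ y 2 < 1) := by
  simp [side, Fin.forall_fin_succ]

theorem injOn_blowUp : InjOn blowUp (univ.pi side) := by
  intro y hy z hz h
  rw [mem_box_iff] at hy hz
  have h0 : y 0 = z 0 := congrFun h 0
  have h1 : y 0 * y 1 = z 0 * z 1 := congrFun h 1
  have h2 : y 0 * y 1 * y 2 = z 0 * z 1 * z 2 := congrFun h 2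
  rw [h0] at h1 h2
  have e1 := mul_left_cancel₀ hz.1.ne' h1
  rw [e1] at h2
  have e2 := mul_left_cancel₀ (mul_pos hz.1 hz.2.1.1).ne' h2
  funext i
  fin_cases i
  exacts [h0, e1, e2]

theorem image_blowUp : blowUp '' univ.pi side = sector := by
  ext x
  constructor
  · rintro ⟨y, hy, rfl⟩
    obtain ⟨h0, ⟨h1, h1'⟩, h2, h2'⟩ := mem_box_iff.1 hy
    refine ⟨?_, ?_, ?_⟩ <;> simp only [blowUp, Matrix.cons_val]
    · exact mul_lt_of_lt_one_right h0 h1'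
    · exact mul_lt_of_lt_one_right (mul_pos h0 h1) h2'
    · positivity
  · rintro ⟨h0, h1, h2⟩
    have p1 : 0 < x 1 := h2.trans h1
    have p0 : 0 < x 0 := p1.trans h0
    refine ⟨![x 0, x 1 / x 0, x 2 / x 1], mem_box_iff.2 ?_, ?_⟩
    · simp only [Matrix.cons_val]
      refine ⟨p0, ⟨by positivity, ?_⟩, by positivity, ?_⟩
      · rwa [div_lt_one p0]
      · rwa [div_lt_one p1]
    · funext i
      fin_cases i <;> simp [blowUp] <;> field_simp

/-- The three denominators in `planck t = bern t / t` contribute `y₀⁻³ y₁⁻¹`, the Jacobian `y₀² y₁`;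
together with the monomial they give the shifts `-3` and `-1` in `blowUpExponent`. -/
theorem integrand_blowUp (s : Fin 3 → ℂ) {y : Fin 3 → ℝ} (hy : y ∈ univ.pi side) :
    |(LinearMap.toContinuousLinearMap (Matrix.toLin' (blowUpJacobian y))).det| •
      (monom s (blowUp y) * weight (blowUp y)) =
    monom (blowUpExponent s) y * blowUpSymbol (toC y) := by
  obtain ⟨h0, ⟨h1, -⟩, h2, -⟩ := mem_box_iff.1 hy
  rw [det_blowUp, abs_of_pos (by positivity)]
  have hw : weight (blowUp y) = planck (y 0 * y 1 * (1 + y 2)) * planck (y 0 * (1 + y 1 * y 2)) *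
      planck (y 0 * (1 + y 1)) := by
    simp only [weight, Fin.prod_univ_three, Fin.sum_univ_three, blowUp, Matrix.cons_val]
    ring_nf
  have hc0 : (y 0 : ℂ) ≠ 0 := by exact_mod_cast h0.ne'
  have hc1 : (y 1 : ℂ) ≠ 0 := by exact_mod_cast h1.ne'
  have hc2 : (y 2 : ℂ) ≠ 0 := by exact_mod_cast h2.ne'
  have hd1 : (1 + y 1 : ℂ) ≠ 0 := by exact_mod_cast (show (1 + y 1 : ℝ) ≠ 0 by positivity)
  have hd2 : (1 + y 2 : ℂ) ≠ 0 := by exact_mod_cast (show (1 + y 2 : ℝ) ≠ 0 by positivity)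
  have hd3 : (1 + y 1 * y 2 : ℂ) ≠ 0 := by
    exact_mod_cast (show (1 + y 1 * y 2 : ℝ) ≠ 0 by positivity)
  rw [hw, planck_eq_bern (by positivity), planck_eq_bern (by positivity),
    planck_eq_bern (by positivity)]
  have hm : monom s (blowUp y) = (y 0 : ℂ) ^ (s 0 + s 1 + s 2 - 3) * (y 1 : ℂ) ^ (s 1 + s 2 - 2) *
      (y 2 : ℂ) ^ (s 2 - 1) := by
    simp only [monom, Fin.prod_univ_three, blowUp, Matrix.cons_val]
    push_cast
    rw [← Complex.ofReal_mul, Complex.mul_cpow_ofReal_nonneg (by positivity) h2.le,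
      Complex.ofReal_mul, Complex.mul_cpow_ofReal_nonneg h0.le h1.le,
      Complex.mul_cpow_ofReal_nonneg h0.le h1.le,
      show s 0 + s 1 + s 2 - 3 = (s 0 - 1) + (s 1 - 1) + (s 2 - 1) by ring,
      show s 1 + s 2 - 2 = (s 1 - 1) + (s 2 - 1) by ring, Complex.cpow_add _ _ hc0,
      Complex.cpow_add _ _ hc0, Complex.cpow_add _ _ hc1]
    ring
  have hm' : monom (blowUpExponent s) y = (y 0 : ℂ) ^ (s 0 + s 1 + s 2 - 3) / y 0 *
      (y 1 : ℂ) ^ (s 1 + s 2 - 2) * (y 2 : ℂ) ^ (s 2 - 1) := by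
    simp only [monom, Fin.prod_univ_three, blowUpExponent, Matrix.cons_val]
    rw [Complex.cpow_sub _ _ hc0, Complex.cpow_one,
      show s 1 + s 2 - 1 - 1 = s 1 + s 2 - 2 by ring]
  rw [hm, hm', blowUpSymbol, Complex.real_smul]
  simp only [toC]
  push_cast
  field_simp

theorem IsSymbol.integrableOn_box {Ψ : (Fin 3 → ℂ) → ℂ} (h : IsSymbol Ψ) {s : Fin 3 → ℂ}
    (hs : ∀ i, 0 < (s i).re) :
    IntegrableOn (fun x => monom s x * Ψ (toC x)) (univ.pi side) := by
  rw [IntegrableOn, ← boxMeasure_eq]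
  exact h.integrable_monom_mul hs

theorem integrableOn_sector {s : Fin 3 → ℂ} (hs : ∀ i, 0 < (blowUpExponent s i).re) :
    IntegrableOn (fun x => monom s x * weight x) sector := by
  rw [← image_blowUp, integrableOn_image_iff_integrableOn_abs_det_fderiv_smul volume
    measurableSet_box (fun y _ => (hasFDerivAt_blowUp y).hasFDerivWithinAt) injOn_blowUp]
  refine (isSymbol_blowUpSymbol.integrableOn_box hs).congr_fun (fun y hy => ?_) measurableSet_box
  exact (integrand_blowUp s hy).symm

theorem integral_sector (s : Fin 3 → ℂ) :
    ∫ x in sector, monom s x * weight x = boxMellin blowUpSymbol (blowUpExponent s) := by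
  rw [← image_blowUp, integral_image_eq_integral_abs_det_fderiv_smul volume
    measurableSet_box (fun y _ => (hasFDerivAt_blowUp y).hasFDerivWithinAt) injOn_blowUp,
    boxMellin, boxMeasure_eq]
  exact setIntegral_congr_fun measurableSet_box fun y hy => integrand_blowUp s hy

theorem measurableSet_sector : MeasurableSet sector := by
  have h0 := measurable_pi_apply (X := fun _ : Fin 3 => ℝ) 0
  have h1 := measurable_pi_apply (X := fun _ : Fin 3 => ℝ) 1
  have h2 := measurable_pi_apply (X := fun _ : Fin 3 => ℝ) 2
  exact (measurableSet_lt h1 h0).inter ((measurableSet_lt h2 h1).inter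
    (measurableSet_lt measurable_const h2))

theorem mem_sector_iff {x : Fin 3 → ℝ} : x ∈ sector ↔ StrictAnti x ∧ ∀ i, 0 < x i := by
  rw [Fin.strictAnti_iff_succ_lt]
  constructor
  · rintro ⟨h0, h1, h2⟩
    refine ⟨fun i => ?_, fun i => ?_⟩
    · fin_cases i
      exacts [h0, h1]
    · fin_cases i
      exacts [h2.trans (h1.trans h0), h2.trans h1, h2]
  · rintro ⟨h, h'⟩
    exact ⟨h 0, h 1, h' 2⟩

/-- The sector in which the coordinates decrease in the order given by a permutation. -/
def permSector (σ : Equiv.Perm (Fin 3)) : Set (Fin 3 → ℝ) := {x | x ∘ σ ∈ sector}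

theorem piCongrLeft_symm_eq (σ : Equiv.Perm (Fin 3)) :
    ⇑(MeasurableEquiv.piCongrLeft (fun _ : Fin 3 => ℝ) σ.symm) = fun x => x ∘ σ := by
  funext x i
  have := MeasurableEquiv.piCongrLeft_apply_apply (β := fun _ : Fin 3 => ℝ) σ.symm x (σ i)
  simpa using this

theorem measurePreserving_comp_perm (σ : Equiv.Perm (Fin 3)) :
    MeasurePreserving (fun x : Fin 3 → ℝ => x ∘ σ) := by
  rw [← piCongrLeft_symm_eq]
  exact volume_measurePreserving_piCongrLeft (fun _ : Fin 3 => ℝ) σ.symm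

theorem measurableEmbedding_comp_perm (σ : Equiv.Perm (Fin 3)) :
    MeasurableEmbedding (fun x : Fin 3 → ℝ => x ∘ σ) := by
  rw [← piCongrLeft_symm_eq]
  exact MeasurableEquiv.measurableEmbedding _

theorem integrand_comp_perm (s : Fin 3 → ℂ) (σ : Equiv.Perm (Fin 3)) :
    (fun x => monom s x * weight x) =
      (fun x => monom (s ∘ σ) x * weight x) ∘ (fun x : Fin 3 → ℝ => x ∘ σ) := by
  funext x
  simp only [Function.comp_apply (f := fun x => monom (s ∘ σ) x * weight x), monom_comp_perm,
    weight_comp_perm]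

/-- The weight is symmetric, so permuting the coordinates only permutes the exponents. -/
theorem integral_permSector (s : Fin 3 → ℂ) (σ : Equiv.Perm (Fin 3)) :
    ∫ x in permSector σ, monom s x * weight x =
      boxMellin blowUpSymbol (blowUpExponent (s ∘ σ)) := by
  rw [integrand_comp_perm s σ, ← integral_sector]
  exact (measurePreserving_comp_perm σ).setIntegral_preimage_emb
    (measurableEmbedding_comp_perm σ) (fun x => monom (s ∘ σ) x * weight x) sector

theorem integrableOn_permSector {s : Fin 3 → ℂ} {σ : Equiv.Perm (Fin 3)}
    (hs : ∀ i, 0 < (blowUpExponent (s ∘ σ) i).re) :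
    IntegrableOn (fun x => monom s x * weight x) (permSector σ) := by
  rw [integrand_comp_perm s σ]
  exact ((measurePreserving_comp_perm σ).integrableOn_comp_preimage
    (measurableEmbedding_comp_perm σ)).2 (integrableOn_sector hs)

/-- If `x` decreases along both `σ` and `τ`, then `σ⁻¹ * τ` is an increasing permutation, hence the
identity. -/
theorem pairwise_disjoint_permSector : Pairwise (Function.onFun Disjoint permSector) := by
  intro σ τ hne
  refine Set.disjoint_left.2 fun x hσ hτ => hne ?_
  have h1 := (mem_sector_iff.1 hσ).1
  have h2 := (mem_sector_iff.1 hτ).1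
  have hmono : StrictMono (σ⁻¹ * τ) := by
    intro i j hij
    refine h1.lt_iff_gt.1 ?_
    simpa using h2 hij
  have hid : (⇑(σ⁻¹ * τ) : Fin 3 → Fin 3) = id :=
    (StrictMono.range_inj hmono strictMono_id).1 (by
      rw [(σ⁻¹ * τ).surjective.range_eq, range_id])
  have h3 : σ⁻¹ * τ = 1 := Equiv.ext fun i => congrFun hid i
  exact inv_mul_eq_one.1 h3

theorem volume_eq_coord {i j : Fin 3} (hij : i ≠ j) :
    (volume : Measure (Fin 3 → ℝ)) {x | x i = x j} = 0 := by
  let S : Submodule ℝ (Fin 3 → ℝ) := LinearMap.ker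
    (LinearMap.proj (R := ℝ) (φ := fun _ : Fin 3 => ℝ) i - LinearMap.proj j)
  have hS : S ≠ ⊤ := by
    intro h
    have : (Pi.single i 1 : Fin 3 → ℝ) ∈ S := by rw [h]; trivial
    simp [S, hij] at this
  have := Measure.addHaar_submodule (volume : Measure (Fin 3 → ℝ)) S hS
  convert this using 2
  ext x
  simp [S, sub_eq_zero]

/-- Off the null hyperplanes `x i = x j`, sorting the negated coordinates finds the sector. -/
theorem octant_ae_eq :
    (univ.pi fun _ : Fin 3 => Ioi (0 : ℝ)) =ᵐ[volume] ⋃ σ, permSector σ := by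
  have hinj : ∀ᵐ x : Fin 3 → ℝ, Function.Injective x := by
    have : ∀ i j : Fin 3, ∀ᵐ x : Fin 3 → ℝ, x i = x j → i = j := by
      intro i j
      by_cases hij : i = j
      · exact Eventually.of_forall fun _ _ => hij
      · rw [ae_iff]
        refine measure_mono_null (fun x hx => ?_) (volume_eq_coord hij)
        simp only [mem_ofPred_eq, Classical.not_imp] at hx
        exact hx.1
    filter_upwards [ae_all_iff.2 fun i => ae_all_iff.2 (this i)] with x hx i j
    exact hx i j
  filter_upwards [hinj] with x hx
  refine propext ?_
  change x ∈ univ.pi (fun _ : Fin 3 => Ioi (0 : ℝ)) ↔ x ∈ ⋃ σ, permSector σ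
  constructor
  · intro h
    have hpos : ∀ i, 0 < x i := fun i => h i (mem_univ i)
    rw [mem_iUnion]
    refine ⟨Tuple.sort (fun i => -x i), mem_sector_iff.2 ⟨?_, fun i => hpos _⟩⟩
    have hm := Tuple.monotone_sort (fun i => -x i)
    have ha : Antitone (x ∘ Tuple.sort (fun i => -x i)) := fun i j hij => by
      have := hm hij
      simpa using this
    exact ha.strictAnti_of_injective (hx.comp (Equiv.injective _))
  · intro h i _
    obtain ⟨σ, hσ⟩ := mem_iUnion.1 h
    have := (mem_sector_iff.1 hσ).2 (σ⁻¹ i)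
    simpa using this

theorem integral_octant {s : Fin 3 → ℂ} (hs : ∀ i, 1 < (s i).re) :
    ∫ x in univ.pi fun _ : Fin 3 => Ioi (0 : ℝ), monom s x * weight x =
      ∑ σ : Equiv.Perm (Fin 3), boxMellin blowUpSymbol (blowUpExponent (s ∘ σ)) := by
  rw [setIntegral_congr_set octant_ae_eq, integral_iUnion_fintype]
  · exact Finset.sum_congr rfl fun σ _ => integral_permSector s σ
  · exact fun σ => (measurePreserving_comp_perm σ).measurable measurableSet_sector
  · exact pairwise_disjoint_permSector
  · refine fun σ => integrableOn_permSector fun i => ?_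
    have h0 := hs (σ 0)
    have h1 := hs (σ 1)
    have h2 := hs (σ 2)
    fin_cases i <;> simp [blowUpExponent] <;> linarith

/-! ### The series as a Mellin transform over the octant. -/

/-- The linear forms `n₁ + n₂`, `n₂ + n₃`, `n₃ + n₁`. -/
def pairSum (n : ℕ+ × ℕ+ × ℕ+) : Fin 3 → ℝ :=
  ![(n.1 : ℝ) + n.2.1, (n.2.1 : ℝ) + n.2.2, (n.2.2 : ℝ) + n.1]

theorem pairSum_pos (n : ℕ+ × ℕ+ × ℕ+) (i : Fin 3) : 0 < pairSum n i := by
  have h1 : (0 : ℝ) < n.1 := by exact_mod_cast n.1.pos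
  have h2 : (0 : ℝ) < n.2.1 := by exact_mod_cast n.2.1.pos
  have h3 : (0 : ℝ) < n.2.2 := by exact_mod_cast n.2.2.pos
  fin_cases i <;> simp [pairSum] <;> positivity

theorem symZetaTerm_eq_prod (s : Fin 3 → ℂ) (n : ℕ+ × ℕ+ × ℕ+) :
    symZetaTerm s n = ∏ i, (1 / (pairSum n i : ℂ)) ^ s i := by
  have h : ∀ i, (1 / (pairSum n i : ℂ)) ^ s i = 1 / (pairSum n i : ℂ) ^ s i := by
    intro i
    rw [one_div, one_div, Complex.inv_cpow]
    rw [Complex.arg_ofReal_of_nonneg (pairSum_pos n i).le]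
    exact Real.pi_ne_zero.symm
  rw [Fin.prod_univ_three, h, h, h]
  simp only [symZetaTerm, pairSum, Matrix.cons_val]
  push_cast
  simp only [one_div, mul_inv]

/-- From `(x + y)² ≥ xy` one gets `(x + y)^(-b) ≤ x^(-b/2) y^(-b/2)`, which separates the variables.
Each index then carries the average of two of the `a i`, still greater than `1`. -/
theorem summable_prod_pairSum {a : Fin 3 → ℝ} (ha : ∀ i, 1 < a i) :
    Summable fun n : ℕ+ × ℕ+ × ℕ+ => ∏ i, (1 / pairSum n i) ^ a i := by
  have h1 : ∀ b : ℝ, 1 < b → Summable fun n : ℕ+ => ((n : ℝ)) ^ (-b) := fun b hb =>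
    (Real.summable_nat_rpow.2 (by linarith)).comp_injective (i := fun n : ℕ+ => (n : ℕ))
      PNat.coe_injective
  have hS := (h1 ((a 0 + a 2) / 2) (by linarith [ha 0, ha 2])).mul_of_nonneg
    ((h1 ((a 0 + a 1) / 2) (by linarith [ha 0, ha 1])).mul_of_nonneg
      (h1 ((a 1 + a 2) / 2) (by linarith [ha 1, ha 2]))
      (fun _ => by positivity) (fun _ => by positivity))
    (fun _ => by positivity) (fun _ => by positivity)
  refine Summable.of_nonneg_of_le (fun n => Finset.prod_nonneg fun i _ =>
    Real.rpow_nonneg (one_div_pos.2 (pairSum_pos n i)).le _) (fun n => ?_) hS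
  obtain ⟨k, l, m⟩ := n
  have hk : (0 : ℝ) < k := by exact_mod_cast k.pos
  have hl : (0 : ℝ) < l := by exact_mod_cast l.pos
  have hm : (0 : ℝ) < m := by exact_mod_cast m.pos
  have key : ∀ x y b : ℝ, 0 < x → 0 < y → 0 ≤ b →
      (1 / (x + y)) ^ b ≤ x ^ (-(b / 2)) * y ^ (-(b / 2)) := by
    intro x y b hx hy hb
    rw [← Real.mul_rpow hx.le hy.le, Real.rpow_neg (by positivity), one_div,
      Real.inv_rpow (by positivity)]
    have h2 : (x * y) ^ (b / 2) ≤ (x + y) ^ b := by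
      calc (x * y) ^ (b / 2) ≤ ((x + y) ^ 2) ^ (b / 2) := by
            gcongr
            nlinarith
        _ = (x + y) ^ b := by
            rw [← Real.rpow_natCast, ← Real.rpow_mul (by positivity)]
            norm_num
            ring_nf
    gcongr
  simp only [Fin.prod_univ_three, pairSum, Matrix.cons_val]
  calc (1 / ((k : ℝ) + l)) ^ a 0 * (1 / ((l : ℝ) + m)) ^ a 1 * (1 / ((m : ℝ) + k)) ^ a 2
      ≤ ((k : ℝ) ^ (-(a 0 / 2)) * (l : ℝ) ^ (-(a 0 / 2))) *
        ((l : ℝ) ^ (-(a 1 / 2)) * (m : ℝ) ^ (-(a 1 / 2))) *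
        ((m : ℝ) ^ (-(a 2 / 2)) * (k : ℝ) ^ (-(a 2 / 2))) := by
        gcongr
        · exact key _ _ _ hk hl (by linarith [ha 0])
        · exact key _ _ _ hl hm (by linarith [ha 1])
        · exact key _ _ _ hm hk (by linarith [ha 2])
    _ = _ := by
        rw [show -((a 0 + a 2) / 2) = -(a 0 / 2) + -(a 2 / 2) by ring,
          show -((a 0 + a 1) / 2) = -(a 0 / 2) + -(a 1 / 2) by ring,
          show -((a 1 + a 2) / 2) = -(a 1 / 2) + -(a 2 / 2) by ring,
          Real.rpow_add hk, Real.rpow_add hl, Real.rpow_add hm]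
        ring

theorem norm_symZetaTerm (s : Fin 3 → ℂ) (n : ℕ+ × ℕ+ × ℕ+) :
    ‖symZetaTerm s n‖ = ∏ i, (1 / pairSum n i) ^ (s i).re := by
  rw [symZetaTerm_eq_prod, norm_prod]
  refine Finset.prod_congr rfl fun i _ => ?_
  rw [← Complex.norm_cpow_eq_rpow_re_of_pos (one_div_pos.2 (pairSum_pos n i))]
  push_cast
  rfl

theorem summable_symZetaTerm {s : Fin 3 → ℂ} (hs : ∀ i, 1 < (s i).re) :
    Summable (symZetaTerm s) := by
  refine Summable.of_norm ?_
  simp only [norm_symZetaTerm]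
  exact summable_prod_pairSum hs

/-- Lebesgue measure on the positive octant. -/
noncomputable def octantMeasure : Measure (Fin 3 → ℝ) :=
  Measure.pi fun _ => volume.restrict (Ioi 0)

theorem octantMeasure_eq :
    octantMeasure = volume.restrict (univ.pi fun _ : Fin 3 => Ioi (0 : ℝ)) := by
  rw [octantMeasure, volume_pi, Measure.restrict_pi_pi]

/-- The Gamma integrand with rate `r`. -/
noncomputable def gammaKernel (s : ℂ) (r t : ℝ) : ℂ := (t : ℂ) ^ (s - 1) * Complex.exp (-(r * t))

theorem integral_gammaKernel {s : ℂ} (hs : 0 < s.re) {r : ℝ} (hr : 0 < r) :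
    ∫ t in Ioi (0 : ℝ), gammaKernel s r t = (1 / (r : ℂ)) ^ s * Complex.Gamma s :=
  Complex.integral_cpow_mul_exp_neg_mul_Ioi hs (by simpa using hr)

theorem integrableOn_gammaKernel {s : ℂ} (hs : 0 < s.re) {r : ℝ} (hr : 0 < r) :
    IntegrableOn (gammaKernel s r) (Ioi 0) := by
  -- Otherwise the integral would be `0` by convention, whereas its known value is nonzero.
  by_contra h
  have h1 := integral_gammaKernel hs hr
  rw [integral_undef h] at h1
  have h2 : (1 / (r : ℂ)) ^ s ≠ 0 := by
    rw [Complex.cpow_ne_zero_iff]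
    exact Or.inl (one_div_ne_zero (by exact_mod_cast hr.ne'))
  exact mul_ne_zero h2 (Complex.Gamma_ne_zero_of_re_pos hs) h1.symm

theorem integral_norm_gammaKernel {s : ℂ} (hs : 0 < s.re) {r : ℝ} (hr : 0 < r) :
    ∫ t in Ioi (0 : ℝ), ‖gammaKernel s r t‖ = (1 / r) ^ s.re * Real.Gamma s.re := by
  rw [← Real.integral_rpow_mul_exp_neg_mul_Ioi hs hr]
  refine setIntegral_congr_fun measurableSet_Ioi fun t ht => ?_
  simp only [gammaKernel]
  rw [norm_mul, Complex.norm_cpow_eq_rpow_re_of_pos ht, Complex.norm_exp]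
  simp

theorem hasSum_pnat_exp {t : ℝ} (ht : 0 < t) :
    HasSum (fun n : ℕ+ => Complex.exp (-(n * t))) (planck t) ∧
      Summable fun n : ℕ+ => ‖Complex.exp (-(n * t))‖ := by
  have hlt : ‖Complex.exp (-t)‖ < 1 := by
    rw [Complex.norm_exp]
    simpa using ht
  have hpow : ∀ n : ℕ, Complex.exp (-((n + 1 : ℕ) * t)) =
      Complex.exp (-t) * Complex.exp (-t) ^ n := by
    intro n
    rw [← Complex.exp_nat_mul, ← Complex.exp_add]
    push_cast
    ring_nf
  have h1 : HasSum (fun n : ℕ => Complex.exp (-((n + 1 : ℕ) * t))) (planck t) := by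
    have hval : planck t = Complex.exp (-t) * (1 - Complex.exp (-t))⁻¹ := by
      have hne : Complex.exp t - 1 ≠ 0 := by
        rw [sub_ne_zero]
        have : Real.exp t ≠ 1 := (Real.one_lt_exp_iff.2 ht).ne'
        exact_mod_cast this
      have hne2 : 1 - (Complex.exp t)⁻¹ ≠ 0 := by
        rw [← Complex.exp_neg, sub_ne_zero]
        intro h
        rw [← h, norm_one] at hlt
        exact lt_irrefl _ hlt
      rw [planck, Complex.exp_neg]
      push_cast
      have := Complex.exp_ne_zero t
      field_simp
    simp only [hpow]
    rw [hval]
    exact (hasSum_geometric_of_norm_lt_one hlt).mul_left (Complex.exp (-t))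
  have h2 : Summable fun n : ℕ => ‖Complex.exp (-((n + 1 : ℕ) * t))‖ := by
    simp only [hpow, norm_mul, norm_pow]
    exact (summable_geometric_of_lt_one (norm_nonneg _) hlt).mul_left _
  let e : ℕ ≃ ℕ+ := Equiv.pnatEquivNat.symm
  constructor
  · rw [← e.hasSum_iff]
    exact h1
  · rw [← e.summable_iff]
    exact h2

/-- Collecting the exponent by `n₁`, `n₂`, `n₃` gives the coefficients `x 0 + x 2`, `x 0 + x 1`, `x
1 + x 2`, so the sum is a product of three geometric series. -/
theorem hasSum_exp_pairSum {x : Fin 3 → ℝ} (hx : ∀ i, 0 < x i) :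
    HasSum (fun n : ℕ+ × ℕ+ × ℕ+ => ∏ i, Complex.exp (-(pairSum n i * x i))) (weight x) := by
  obtain ⟨a1, b1⟩ := hasSum_pnat_exp (t := x 0 + x 2) (add_pos (hx 0) (hx 2))
  obtain ⟨a2, b2⟩ := hasSum_pnat_exp (t := x 0 + x 1) (add_pos (hx 0) (hx 1))
  obtain ⟨a3, b3⟩ := hasSum_pnat_exp (t := x 1 + x 2) (add_pos (hx 1) (hx 2))
  have c23 := summable_mul_of_summable_norm b2 b3
  have d23 := a2.mul a3 c23
  have c := summable_mul_of_summable_norm b1 (summable_norm_iff.2 c23)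
  have d := a1.mul d23 c
  have hw : weight x = planck (x 0 + x 2) * (planck (x 0 + x 1) * planck (x 1 + x 2)) := by
    rw [weight, Fin.prod_univ_three, Fin.sum_univ_three,
      show x 0 + x 1 + x 2 - x 0 = x 1 + x 2 by ring,
      show x 0 + x 1 + x 2 - x 1 = x 0 + x 2 by ring,
      show x 0 + x 1 + x 2 - x 2 = x 0 + x 1 by ring]
    ring
  rw [hw]
  refine d.congr_fun fun n => ?_
  simp only [Fin.prod_univ_three, pairSum, Matrix.cons_val, ← Complex.exp_add]
  push_cast
  ring_nf

/-- Sum and integral may be exchanged because the integrals of the norms are again Gamma integrals,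
summing to a constant times the series at the real parts. -/
theorem tsum_symZetaTerm_mul_Gamma {s : Fin 3 → ℂ} (hs : ∀ i, 1 < (s i).re) :
    (∑' n, symZetaTerm s n) * ∏ i, Complex.Gamma (s i) =
      ∑ σ : Equiv.Perm (Fin 3), boxMellin blowUpSymbol (blowUpExponent (s ∘ σ)) := by
  have hs0 : ∀ i, 0 < (s i).re := fun i => one_pos.trans (hs i)
  rw [← integral_octant hs, ← octantMeasure_eq, ← tsum_mul_right]
  let F : ℕ+ × ℕ+ × ℕ+ → (Fin 3 → ℝ) → ℂ := fun n x =>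
    ∏ i, gammaKernel (s i) (pairSum n i) (x i)
  have hFi : ∀ n, Integrable (F n) octantMeasure := fun n =>
    Integrable.fintype_prod (f := fun i => gammaKernel (s i) (pairSum n i)) fun i =>
      integrableOn_gammaKernel (hs0 i) (pairSum_pos n i)
  have hFv : ∀ n, ∫ x, F n x ∂octantMeasure =
      symZetaTerm s n * ∏ i, Complex.Gamma (s i) := by
    intro n
    rw [symZetaTerm_eq_prod, ← Finset.prod_mul_distrib]
    refine (integral_fintype_prod_eq_prod (fun i => gammaKernel (s i) (pairSum n i))).trans ?_
    exact Finset.prod_congr rfl fun i _ => integral_gammaKernel (hs0 i) (pairSum_pos n i)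
  have hFn : ∀ n, ∫ x, ‖F n x‖ ∂octantMeasure =
      (∏ i, (1 / pairSum n i) ^ (s i).re) * ∏ i, Real.Gamma (s i).re := by
    intro n
    rw [← Finset.prod_mul_distrib]
    simp only [F, norm_prod]
    refine (integral_fintype_prod_eq_prod (fun i t => ‖gammaKernel (s i) (pairSum n i) t‖)).trans ?_
    exact Finset.prod_congr rfl fun i _ => integral_norm_gammaKernel (hs0 i) (pairSum_pos n i)
  have hsum : Summable fun n => ∫ x, ‖F n x‖ ∂octantMeasure := by
    simp only [hFn]
    exact (summable_prod_pairSum hs).mul_right _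
  simp only [← hFv]
  rw [integral_tsum_of_summable_integral_norm hFi hsum]
  · refine integral_congr_ae ?_
    have hae : ∀ᵐ x ∂octantMeasure, ∀ i, 0 < x i := by
      rw [octantMeasure_eq]
      filter_upwards [ae_restrict_mem (MeasurableSet.univ_pi fun _ => measurableSet_Ioi)]
        with x hx i
      exact hx i (mem_univ i)
    filter_upwards [hae] with x hx
    have h1 := (hasSum_exp_pairSum hx).mul_left (monom s x)
    rw [← h1.tsum_eq]
    refine tsum_congr fun n => ?_
    simp only [F, gammaKernel, monom, Finset.prod_mul_distrib]

/-! ### Poles of the Gamma factors. -/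

/-- The arguments of the Gamma functions whose poles are the possible singularities. -/
noncomputable def polarArg (c : Fin 4) (s : Fin 3 → ℂ) : ℂ :=
  ![s 0 + s 1 - 1, s 1 + s 2 - 1, s 2 + s 0 - 1, s 0 + s 1 + s 2 - 3] c

theorem symZetaForm_eq (c : Fin 4) (k : ℕ+) (s : Fin 3 → ℂ) :
    symZetaForm (c, k) s = polarArg c s + ((k : ℂ) - 1) := by
  fin_cases c <;> simp [symZetaForm, polarArg] <;> ring

theorem analyticAt_polarArg (c : Fin 4) (p : Fin 3 → ℂ) : AnalyticAt ℂ (polarArg c) p := by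
  have h0 := analyticAt_coord 0 p
  have h1 := analyticAt_coord 1 p
  have h2 := analyticAt_coord 2 p
  fin_cases c
  · exact (h0.add h1).sub analyticAt_const
  · exact (h1.add h2).sub analyticAt_const
  · exact (h2.add h0).sub analyticAt_const
  · exact ((h0.add h1).add h2).sub analyticAt_const

theorem analyticAt_symZetaForm (j : Fin 4 × ℕ+) (p : Fin 3 → ℂ) :
    AnalyticAt ℂ (symZetaForm j) p := by
  obtain ⟨c, k⟩ := j
  have h : symZetaForm (c, k) = fun s => polarArg c s + ((k : ℂ) - 1) :=
    funext (symZetaForm_eq c k)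
  rw [h]
  exact (analyticAt_polarArg c p).add analyticAt_const

theorem polarArg_add_diagonal (c : Fin 4) (p : Fin 3 → ℂ) (ε : ℂ) :
    polarArg c (p + fun _ => ε) = polarArg c p + (if c = 3 then 3 else 2) * ε := by
  fin_cases c <;> simp [polarArg] <;> ring

theorem analyticAt_Gamma {z : ℂ} (hz : ∀ m : ℕ, z ≠ -m) : AnalyticAt ℂ Complex.Gamma z := by
  have h := (Complex.differentiable_one_div_Gamma.analyticAt z).inv
    (inv_ne_zero (Complex.Gamma_ne_zero hz))
  refine h.congr (Eventually.of_forall fun w => ?_)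
  exact inv_inv _

/-- Induction by `Γ(w) = Γ(w + 1) / w`: at `0` the division creates the simple pole, while at `-(m +
1)` it is harmless and the pole is inherited from `-m`. -/
theorem Gamma_eq_div_near_pole (m : ℕ) : ∀ z : ℂ, z = -m →
    ∃ g : ℂ → ℂ, AnalyticAt ℂ g z ∧
      ∀ᶠ w : ℂ in 𝓝 z, w + m ≠ 0 → Complex.Gamma w = g w / (w + m) := by
  induction m with
  | zero =>
    intro z hz
    refine ⟨fun w => Complex.Gamma (w + 1), ?_, Eventually.of_forall fun w hw => ?_⟩
    · refine AnalyticAt.comp (g := Complex.Gamma) (analyticAt_Gamma fun m h => ?_)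
        (analyticAt_id.add analyticAt_const)
      rw [hz] at h
      have h1 : ((m + 1 : ℕ) : ℂ) = 0 := by push_cast at h ⊢; linear_combination h
      exact Nat.cast_ne_zero.2 (Nat.succ_ne_zero m) h1
    · simp only [Nat.cast_zero, add_zero] at hw ⊢
      rw [Complex.Gamma_add_one _ hw]
      field_simp
  | succ m ih =>
    intro z hz
    have hz0 : z ≠ 0 := by
      rw [hz]
      exact neg_ne_zero.2 (Nat.cast_ne_zero.2 (Nat.succ_ne_zero m))
    obtain ⟨g, hg, hgw⟩ := ih (z + 1) (by rw [hz]; push_cast; ring)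
    refine ⟨fun w => g (w + 1) / w, ?_, ?_⟩
    · exact (AnalyticAt.comp (g := g) (f := fun w => w + 1) hg
        (analyticAt_id.add analyticAt_const)).div analyticAt_id hz0
    · have hc : ContinuousAt (fun w : ℂ => w + 1) z := by fun_prop
      filter_upwards [hc.eventually hgw, isOpen_ne.mem_nhds hz0] with w h1 h2 h3
      have h4 : w + 1 + m ≠ 0 := by
        intro h; apply h3; push_cast; linear_combination h
      have h5 := h1 h4
      rw [Complex.Gamma_add_one _ h2] at h5
      have h6 : Complex.Gamma w = g (w + 1) / (w + 1 + m) / w := by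
        rw [← h5]; field_simp [show w ≠ 0 from h2]
      rw [h6]
      push_cast
      rw [div_div, div_div, show (w + 1 + m) * w = w * (w + (m + 1)) by ring]

theorem exists_local_form_Gamma_polarArg (c : Fin 4) (p : Fin 3 → ℂ) :
    ∃ S : Finset ℕ+, (∀ k ∈ S, symZetaForm (c, k) p = 0) ∧ ∃ g : (Fin 3 → ℂ) → ℂ,
      AnalyticAt ℂ g p ∧ ∀ᶠ s in 𝓝 p, (∀ k ∈ S, symZetaForm (c, k) s ≠ 0) →
        Complex.Gamma (polarArg c s) = g s / ∏ k ∈ S, symZetaForm (c, k) s := by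
  by_cases h : ∃ m : ℕ, polarArg c p = -m
  · obtain ⟨m, hm⟩ := h
    obtain ⟨g, hg, hgw⟩ := Gamma_eq_div_near_pole m _ hm
    -- The hyperplanes are numbered from `k = 1`, so the pole at `-m` has index `k = m + 1`.
    have hform : ∀ s, symZetaForm (c, m.succPNat) s = polarArg c s + m := by
      intro s; rw [symZetaForm_eq]; simp
    refine ⟨{m.succPNat}, ?_, fun s => g (polarArg c s), hg.comp (analyticAt_polarArg c p), ?_⟩
    · intro k hk
      rw [Finset.mem_singleton.1 hk, hform, hm]
      ring
    · filter_upwards [(analyticAt_polarArg c p).continuousAt.eventually hgw] with s hs hne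
      rw [Finset.prod_singleton, hform]
      refine hs ?_
      rw [← hform]
      exact hne _ (Finset.mem_singleton_self _)
  · push Not at h
    refine ⟨∅, by simp, fun s => Complex.Gamma (polarArg c s),
      AnalyticAt.comp (analyticAt_Gamma h) (analyticAt_polarArg c p),
      Eventually.of_forall fun s _ => by simp⟩

/-- The sum of two coordinates is the total minus the third, so only the value `σ 0` matters. -/
theorem exists_polarArg_eq (σ : Equiv.Perm (Fin 3)) :
    ∃ c : Fin 4, c ≠ 3 ∧ ∀ s : Fin 3 → ℂ, s (σ 1) + s (σ 2) - 1 = polarArg c s := by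
  have hsum : ∀ s : Fin 3 → ℂ, s (σ 0) + s (σ 1) + s (σ 2) = s 0 + s 1 + s 2 := by
    intro s
    have := Equiv.sum_comp σ s
    rwa [Fin.sum_univ_three, Fin.sum_univ_three] at this
  have h : ∀ s : Fin 3 → ℂ, s (σ 1) + s (σ 2) - 1 = s 0 + s 1 + s 2 - s (σ 0) - 1 := fun s => by
    linear_combination hsum s
  generalize σ 0 = i at h
  simp only [h]
  fin_cases i
  · exact ⟨1, by decide, fun s => by simp [polarArg]; ring⟩
  · exact ⟨2, by decide, fun s => by simp [polarArg]; ring⟩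
  · exact ⟨0, by decide, fun s => by simp [polarArg]⟩

theorem analyticAt_blowUpExponent (σ : Equiv.Perm (Fin 3)) (p : Fin 3 → ℂ) :
    AnalyticAt ℂ (fun s : Fin 3 → ℂ => blowUpExponent (s ∘ σ)) p := by
  have h0 := analyticAt_coord (σ 0) p
  have h1 := analyticAt_coord (σ 1) p
  have h2 := analyticAt_coord (σ 2) p
  refine AnalyticAt.pi fun i => ?_
  fin_cases i
  · exact ((h0.add h1).add h2).sub analyticAt_const
  · exact (h1.add h2).sub analyticAt_const
  · exact h2

/-! ### The continuation formula and its local structure. -/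

/-- The symmetric zeta series is a sum of products of two Gamma functions and an entire
function. -/
theorem exists_entire_coefficients : ∃ (c : Equiv.Perm (Fin 3) → Fin 4)
    (A : Equiv.Perm (Fin 3) → (Fin 3 → ℂ) → ℂ), (∀ σ, c σ ≠ 3) ∧ (∀ σ s, AnalyticAt ℂ (A σ) s) ∧
      ∀ s : Fin 3 → ℂ, (∀ i, 1 < (s i).re) → ∑' n, symZetaTerm s n =
        ∑ σ, Complex.Gamma (polarArg 3 s) * Complex.Gamma (polarArg (c σ) s) * A σ s := by
  obtain ⟨E, hE, hEK⟩ := isSymbol_blowUpSymbol.exists_entire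
  choose c hc3 hc using exists_polarArg_eq
  -- Only two inverse Gamma factors appear: the third cancels `Γ(s (σ 2))`, which comes from the
  -- last blow-up exponent.
  refine ⟨c, fun σ s => E (blowUpExponent (s ∘ σ)) * ((Complex.Gamma (s (σ 0)))⁻¹ *
    (Complex.Gamma (s (σ 1)))⁻¹), hc3, fun σ s => ?_, fun s hs => ?_⟩
  · have hG : ∀ i, AnalyticAt ℂ (fun s : Fin 3 → ℂ => (Complex.Gamma (s i))⁻¹) s := fun i =>
      AnalyticAt.comp (g := fun z => (Complex.Gamma z)⁻¹)
        (Complex.differentiable_one_div_Gamma.analyticAt _) (analyticAt_coord i s)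
    exact (AnalyticAt.comp (g := E) (hE _) (analyticAt_blowUpExponent σ s)).mul
      ((hG _).mul (hG _))
  · have hΓ : ∀ i, Complex.Gamma (s i) ≠ 0 := fun i =>
      Complex.Gamma_ne_zero_of_re_pos (one_pos.trans (hs i))
    have hprod : ∏ i, Complex.Gamma (s i) ≠ 0 := Finset.prod_ne_zero_iff.2 fun i _ => hΓ i
    refine mul_right_cancel₀ hprod ?_
    rw [tsum_symZetaTerm_mul_Gamma hs, Finset.sum_mul]
    refine Finset.sum_congr rfl fun σ _ => ?_
    have hpos : ∀ i, 0 < (blowUpExponent (s ∘ σ) i).re := by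
      have h0 := hs (σ 0)
      have h1 := hs (σ 1)
      have h2 := hs (σ 2)
      intro i
      fin_cases i <;> simp [blowUpExponent] <;> linarith
    rw [hEK _ hpos, ← hc σ s, ← Equiv.prod_comp σ fun i => Complex.Gamma (s i),
      Fin.prod_univ_three, Fin.prod_univ_three]
    have hsum : s (σ 0) + s (σ 1) + s (σ 2) - 3 = polarArg 3 s := by
      have := Equiv.sum_comp σ s
      rw [Fin.sum_univ_three, Fin.sum_univ_three] at this
      simp [polarArg, this]
    simp only [blowUpExponent, Matrix.cons_val, Function.comp_apply, hsum]
    have g0 := hΓ (σ 0)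
    have g1 := hΓ (σ 1)
    field_simp

/-- The common denominator is the product of the local denominators of all four Gamma families. As
`c σ ≠ 3`, each summand uses two different ones, each once, and is multiplied by the other two; no
form gets squared. -/
theorem exists_local_quotient {F : (Fin 3 → ℂ) → ℂ} {c : Equiv.Perm (Fin 3) → Fin 4}
    {A : Equiv.Perm (Fin 3) → (Fin 3 → ℂ) → ℂ} (hc : ∀ σ, c σ ≠ 3)
    (hA : ∀ σ s, AnalyticAt ℂ (A σ) s)
    (hF : ∀ s, F s = ∑ σ, Complex.Gamma (polarArg 3 s) * Complex.Gamma (polarArg (c σ) s) * A σ s)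
    (p : Fin 3 → ℂ) :
    ∃ T : Finset (Fin 4 × ℕ+), (∀ j ∈ T, symZetaForm j p = 0) ∧ ∃ g : (Fin 3 → ℂ) → ℂ,
      AnalyticAt ℂ g p ∧ ∀ᶠ s in 𝓝 p, (∀ j ∈ T, symZetaForm j s ≠ 0) →
        F s = g s / ∏ j ∈ T, symZetaForm j s := by
  choose S hS g hg hgS using fun a => exists_local_form_Gamma_polarArg a p
  let d : Fin 4 → (Fin 3 → ℂ) → ℂ := fun a s => ∏ k ∈ S a, symZetaForm (a, k) s
  have hd : ∀ a, AnalyticAt ℂ (d a) p := fun a =>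
    Finset.analyticAt_fun_prod _ fun k _ => analyticAt_symZetaForm (a, k) p
  let T : Finset (Fin 4 × ℕ+) := Finset.univ.biUnion fun a => (S a).image fun k => (a, k)
  have hT : ∀ j : Fin 4 × ℕ+, j ∈ T ↔ j.1 ∈ Finset.univ ∧ j.2 ∈ S j.1 := by
    rintro ⟨a, k⟩
    simp only [T, Finset.mem_biUnion, Finset.mem_image, Finset.mem_univ, true_and, Prod.mk.injEq]
    constructor
    · rintro ⟨_, _, h, rfl, rfl⟩
      exact h
    · exact fun h => ⟨a, k, h, rfl, rfl⟩
  refine ⟨T, fun j hj => hS j.1 j.2 ((hT j).1 hj).2, fun s => ∑ σ, g 3 s * g (c σ) s * A σ s *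
    ∏ a ∈ (Finset.univ.erase 3).erase (c σ), d a s, ?_, ?_⟩
  · exact Finset.analyticAt_fun_sum _ fun σ _ => (((hg 3).mul (hg _)).mul (hA σ p)).mul
      (Finset.analyticAt_fun_prod _ fun a _ => hd a)
  · filter_upwards [eventually_all.2 hgS] with s hs hne
    have hne' : ∀ a, ∀ k ∈ S a, symZetaForm (a, k) s ≠ 0 := fun a k hk =>
      hne (a, k) ((hT (a, k)).2 ⟨Finset.mem_univ a, hk⟩)
    have hd0 : ∀ a, d a s ≠ 0 := fun a => Finset.prod_ne_zero_iff.2 fun k hk => hne' a k hk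
    rw [Finset.prod_finset_product T Finset.univ S hT, hF, Finset.sum_div]
    refine Finset.sum_congr rfl fun σ _ => ?_
    rw [hs 3 (hne' 3), hs (c σ) (hne' _)]
    change g 3 s / d 3 s * (g (c σ) s / d (c σ) s) * A σ s = _ / ∏ a, d a s
    rw [← Finset.mul_prod_erase Finset.univ (fun a => d a s) (Finset.mem_univ 3),
      ← Finset.mul_prod_erase (Finset.univ.erase 3) (fun a => d a s)
        (Finset.mem_erase.2 ⟨hc σ, Finset.mem_univ (c σ)⟩)]
    have h1 := hd0 3
    have h2 := hd0 (c σ)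
    have h3 : ∏ a ∈ (Finset.univ.erase 3).erase (c σ), d a s ≠ 0 :=
      Finset.prod_ne_zero_iff.2 fun a _ => hd0 a
    field_simp

/-- Along the diagonal direction `(1, 1, 1)` every form has slope `2` or `3`, so none of those
vanishing at `p` vanishes again at nearby points of that line. -/
theorem not_eventually_prod_symZetaForm_eq_zero {T : Finset (Fin 4 × ℕ+)} {p : Fin 3 → ℂ}
    (hT : ∀ j ∈ T, symZetaForm j p = 0) :
    ¬ ∀ᶠ s in 𝓝 p, ∏ j ∈ T, symZetaForm j s = 0 := by
  intro h
  have hc : Tendsto (fun ε : ℂ => p + fun _ => ε) (𝓝[≠] 0) (𝓝 p) := by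
    have : ContinuousAt (fun ε : ℂ => p + fun _ : Fin 3 => ε) 0 := by fun_prop
    have h2 := this.tendsto.mono_left (nhdsWithin_le_nhds (s := {0}ᶜ))
    have h3 : (p + fun _ : Fin 3 => (0 : ℂ)) = p := by
      funext i; simp
    rwa [h3] at h2
  obtain ⟨ε, hε, hε0⟩ := ((hc.eventually h).and self_mem_nhdsWithin).exists
  obtain ⟨⟨c, k⟩, hj, hz⟩ := Finset.prod_eq_zero_iff.1 hε
  have h1 := hT _ hj
  rw [symZetaForm_eq] at hz h1
  rw [polarArg_add_diagonal] at hz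
  have h2 : (if c = 3 then (3 : ℂ) else 2) * ε = 0 := by linear_combination hz - h1
  refine mul_ne_zero ?_ hε0 h2
  split_ifs <;> norm_num

end SymZeta

theorem theorem1p1 :
    (∀ s : Fin 3 → ℂ, (∀ i, 1 < (s i).re) → Summable (symZetaTerm s)) ∧
    ∃ F : (Fin 3 → ℂ) → ℂ,
      (∀ s : Fin 3 → ℂ, (∀ i, 1 < (s i).re) → F s = ∑' n : ℕ+ × ℕ+ × ℕ+, symZetaTerm s n) ∧
      IsMeromorphicMV F ∧
      HasOnlySimplePolesAlong symZetaForm F := by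
  refine ⟨fun s hs => SymZeta.summable_symZetaTerm hs, ?_⟩
  obtain ⟨c, A, hc, hA, hsum⟩ := SymZeta.exists_entire_coefficients
  -- Unification with `rfl` makes the continuation the explicit sum of Gamma products, defined on
  -- all of `ℂ³`.
  have key := SymZeta.exists_local_quotient hc hA (fun s => rfl)
  refine ⟨_, fun s hs => (hsum s hs).symm, fun p => ?_, fun p hp => ?_, fun p => ?_⟩
  · obtain ⟨T, hT, g, hg, h⟩ := key p
    refine ⟨g, fun s => ∏ j ∈ T, symZetaForm j s, hg,
      Finset.analyticAt_fun_prod _ fun j _ => SymZeta.analyticAt_symZetaForm j p,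
      SymZeta.not_eventually_prod_symZetaForm_eq_zero hT, ?_⟩
    filter_upwards [h] with s hs hne
    exact hs (Finset.prod_ne_zero_iff.1 hne)
  · obtain ⟨T, hT, g, hg, h⟩ := key p
    -- Off the hyperplanes no form can occur in the denominator, so the function coincides with the
    -- holomorphic numerator near `p`.
    have hT0 : T = ∅ := Finset.eq_empty_of_forall_notMem fun j hj => hp j (hT j hj)
    subst hT0
    refine hg.congr ?_
    filter_upwards [h] with s hs
    simpa using (hs (by simp)).symm
  · obtain ⟨T, hT, g, hg, h⟩ := key p
    refine ⟨T, hT, g, hg, ?_⟩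
    filter_upwards [h] with s hs hne
    exact hs fun j _ => hne j
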